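/- For a real or complex number $x$ write $|x|_+ := \max(|x|,1)$. There is a universal constant $K>0$ with the following property. Let $T\subset\mathbb{C}$ be a simply connected domain, let $g:T\to\mathbb{C}$ be holomorphic, and let $\gamma:(-\infty,\infty)\to T$ be an injective, piecewise smooth curve with $|\gamma(t)|\to\infty$ as $|t|\to\infty$. Let $\tilde T$ be a connected component of $\mathbb{C}\setminus\gamma$ that is contained in $T$, and assume that $\gamma$ runs around $\tilde T$ in clockwise direction. Suppose that there are constants $C_1,\dots,C_5\ge 1$ and $\delta_1,\delta_2\ge 0$ such that, for all $\tau\in\mathbb{R}$, (a) $|\gamma(\tau)|\le C_1\,|\tau|_+$; (b) $|\gamma'(\tau)|\le C_2\,|\tau|_+^{\delta_1}$ (wherever $\gamma$ is differentiable); (c) $|g(\gamma(\tau))|\le C_3\,|\tau|_+^{-(2+\delta_1+\delta_2)}$; (d) if $z\in\mathbb{C}$ and $|z-\gamma(\tau)|\le |\tau|_+^{-\delta_2}/C_4$, then $z\in T$ and $|g(z)|\le C_5\,|\tau|_+^{-1}$. Then, for every $z\in\mathbb{C}\setminus\gamma$, the integral $$h(z):=\frac{1}{2\pi i}\int_\gamma\frac{g(\zeta)}{\zeta-z}\,d\zeta$$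 converges absolutely; the function $h$ is holomorphic on $\mathbb{C}\setminus\gamma$; and the function defined on $\mathbb{C}\setminus\gamma$ by $$f(z):=\begin{cases}h(z)+g(z), & z\in\tilde T,\\ h(z), & z\notin\tilde T\cup\gamma,\end{cases}$$ extends to an entire function. Furthermore, $$|h(z)|\le\frac{C_6}{|z|_+}\quad\text{for all } z\in\mathbb{C}\setminus\gamma,\qquad\text{where } C_6 = K\cdot C_1C_2C_3C_4C_5 .$$ -/

import Mathlib

open Complex Set Filter Topology MeasureTheory

noncomputable section

/-- The truncated modulus `|z|₊ = max (|z|, 1)`, for real and for complex arguments. -/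
def plusNorm {E : Type*} [Norm E] (z : E) : ℝ := max ‖z‖ 1

/-- A piecewise smooth curve `γ : (-∞, ∞) → ℂ`: it is continuous, and there is a set `E` of break
points, finite in every bounded interval, such that `γ` is continuously differentiable on every
compact interval without break points in its interior (with one-sided derivatives at the end
points of the interval). The derivative is allowed to vanish. -/
def IsPiecewiseSmooth (γ : ℝ → ℂ) : Prop :=
  Continuous γ ∧
    ∃ E : Set ℝ, (∀ R : ℝ, (E ∩ Icc (-R) R).Finite) ∧
      ∀ a b : ℝ, a < b → Disjoint (Ioo a b) E → ContDiffOn ℝ 1 γ (Icc a b)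

/-- `U` is a connected component of `S`. -/
def IsComponentOf (U S : Set ℂ) : Prop :=
  ∃ z ∈ S, U = connectedComponentIn S z

/-- Let `γ` be a curve in `ℂ` both of whose ends tend to `∞`, and let `w₀`, `w₁` be points off `γ`.
Then `t ↦ (γ t - w₀) / (γ t - w₁)` is a loop in `ℂ ∖ {0}` that starts and ends at `1`. This says
that the loop winds `n` times (counter-clockwise) around `0`: the continuous branch of its
logarithm that starts at `0` ends at `2 π i n`.

Up to a constant factor the loop is `1 / (γ t - w₁) - 1 / (w₀ - w₁)`. So `n` is the ordinary
winding number around the image of `w₀` of the closed curve that is the image of `γ ∪ {∞}` under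
the Möbius transformation `ζ ↦ 1 / (ζ - w₁)` sending `w₁` to `∞`. -/
def HasRelativeWindingNumber (γ : ℝ → ℂ) (w₀ w₁ : ℂ) (n : ℤ) : Prop :=
  ∃ θ : ℝ → ℂ, Continuous θ ∧
    (∀ t, Complex.exp (θ t) = (γ t - w₀) / (γ t - w₁)) ∧
    Tendsto θ atBot (𝓝 0) ∧
    Tendsto θ atTop (𝓝 (2 * Real.pi * Complex.I * n))

/-- The curve `γ` (both of whose ends tend to `∞`) runs around the complementary component `U` in
clockwise direction: its winding number around the points of `U`, relative to the points outside
`U`, is `-1`. For example the imaginary axis, traversed upwards, runs clockwise around the right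
half plane. -/
def RunsClockwiseAround (γ : ℝ → ℂ) (U : Set ℂ) : Prop :=
  ∀ w₀ ∈ U, ∀ w₁ : ℂ, w₁ ∉ U → w₁ ∉ range γ → HasRelativeWindingNumber γ w₀ w₁ (-1)

/-- The integrand of the Cauchy integral of `g` over `γ`, in the parameter of `γ`. -/
def cauchyIntegrand (γ : ℝ → ℂ) (g : ℂ → ℂ) (z : ℂ) (t : ℝ) : ℂ :=
  g (γ t) / (γ t - z) * deriv γ t

/-- The Cauchy integral `(2 π i)⁻¹ ∫_γ g(ζ) / (ζ - z) dζ`. -/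
def cauchyTransform (γ : ℝ → ℂ) (g : ℂ → ℂ) (z : ℂ) : ℂ :=
  (2 * Real.pi * Complex.I)⁻¹ * ∫ t : ℝ, cauchyIntegrand γ g z t

end

noncomputable section

/-! ### Continuous logarithms and relative winding numbers -/

/-! The growth conditions give `‖g (γ t) * deriv γ t‖ ≤ C₂C₃|t|₊^(-(2+δ₂))`, so `h` converges
absolutely and is holomorphic off `γ`.

To cross `γ` at `γ t₀`, write `g(ζ)/(ζ-w) = (g(ζ)-g(w))/(ζ-w) + g(w)/(ζ-w)` on a short arc. The
first part integrates to a holomorphic function of `w`. The second gives `g(w)` times a logarithmic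
integral, whose jump is `2πi` times a relative winding number, hence is governed by the
characteristic function `χ` of `T'`. So `h + χ g` continues across each point of `γ`
(`exists_local_extension`). As `γ` is a closed null set, its complement is dense and the local
continuations agree (`exists_entire_extension`). The clockwise hypothesis only compares points
inside `T'` with points outside, so outside points must exist: `not_isPreconnected_compl_range`.

For the bound let `r(t) = |t|₊^(-δ₂)/C₄`. If `z` has distance more than `r(t)/2` from every `γ t`,
the integral is estimated directly: small parameters have `‖γ t - z‖ ≥ |z|₊/2`, and for the others
the density beats the kernel, leaving a tail of `∫ |t|₊⁻²`. If `z` is close to `γ`, the entire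
function `f = h + χ g` has the sub-mean value property on a small disc about `z`; averaging replaces
the singular kernel by a bounded one (`norm_le_of_average_kernel`), and `h = f - χ g` with `g` small
near `γ`. -/

lemma eq_of_exp_eq_one {S : Set ℝ} (hS : IsPreconnected S) {φ : ℝ → ℂ}
    (hφ : ContinuousOn φ S) (h1 : ∀ t ∈ S, Complex.exp (φ t) = 1) {x y : ℝ}
    (hx : x ∈ S) (hy : y ∈ S) : φ x = φ y := by
  have hpi : (2 * Real.pi * Complex.I : ℂ) ≠ 0 := Complex.two_pi_I_ne_zero
  have key : ∀ t ∈ S, ∃ n : ℤ, φ t = n * (2 * Real.pi * Complex.I) :=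
    fun t ht => Complex.exp_eq_one_iff.1 (h1 t ht)
  -- Up to the factor `2πi`, the continuous function `φ` takes values in the discrete set of
  -- integers.
  have hm : MapsTo (fun t => (φ t / (2 * Real.pi * Complex.I)).re) S
      (range ((↑) : ℤ → ℝ)) := by
    intro t ht
    obtain ⟨n, hn⟩ := key t ht
    refine ⟨n, ?_⟩
    simp only [hn, mul_div_cancel_right₀ _ hpi, Complex.intCast_re]
  have hd : DiscreteTopology (range ((↑) : ℤ → ℝ)) :=
    (Int.isClosedEmbedding_coe_real.isEmbedding.toHomeomorph).discreteTopology
  have := hS.constant_of_mapsTo (hd.isDiscrete)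
    (Complex.continuous_re.comp_continuousOn (hφ.div_const _)) hm hx hy
  obtain ⟨n, hn⟩ := key x hx
  obtain ⟨m, hm⟩ := key y hy
  simp only [Function.comp, hn, hm, mul_div_cancel_right₀ _ hpi, Complex.intCast_re] at this
  rw [hn, hm, show n = m by exact_mod_cast this]

lemma sub_eq_sub_of_exp_eq {S : Set ℝ} (hS : IsPreconnected S) {φ ψ : ℝ → ℂ}
    (hφ : ContinuousOn φ S) (hψ : ContinuousOn ψ S)
    (h1 : ∀ t ∈ S, Complex.exp (φ t) = Complex.exp (ψ t)) {x y : ℝ}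
    (hx : x ∈ S) (hy : y ∈ S) : φ y - φ x = ψ y - ψ x := by
  have := eq_of_exp_eq_one hS (hφ.sub hψ)
    (fun t ht => by rw [Pi.sub_apply, Complex.exp_sub, h1 t ht, div_self (Complex.exp_ne_zero _)])
    hx hy
  simp only [Pi.sub_apply] at this
  linear_combination -this

lemma HasRelativeWindingNumber.trans {γ : ℝ → ℂ} {w₀ w₁ w₂ : ℂ} {m n : ℤ}
    (h : HasRelativeWindingNumber γ w₀ w₁ m) (h' : HasRelativeWindingNumber γ w₁ w₂ n)
    (hw : w₁ ∉ range γ) : HasRelativeWindingNumber γ w₀ w₂ (m + n) := by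
  obtain ⟨θ, h1, h2, h3, h4⟩ := h
  obtain ⟨θ', h1', h2', h3', h4'⟩ := h'
  refine ⟨fun t => θ t + θ' t, h1.add h1', fun t => ?_, by simpa using h3.add h3', ?_⟩
  · have : γ t - w₁ ≠ 0 := sub_ne_zero.2 fun h => hw ⟨t, h⟩
    rw [Complex.exp_add, h2, h2']
    field_simp
  · convert h4.add h4' using 2
    push_cast; ring

lemma HasRelativeWindingNumber.symm {γ : ℝ → ℂ} {w₀ w₁ : ℂ} {n : ℤ}
    (h : HasRelativeWindingNumber γ w₀ w₁ n) : HasRelativeWindingNumber γ w₁ w₀ (-n) := by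
  obtain ⟨θ, h1, h2, h3, h4⟩ := h
  refine ⟨fun t => - θ t, h1.neg, fun t => ?_, by simpa using h3.neg, ?_⟩
  · rw [Complex.exp_neg, h2, inv_div]
  · convert h4.neg using 2
    push_cast; ring

lemma div_mem_slitPlane {z w w' : ℂ} (h : ‖w - w'‖ < ‖z - w'‖) :
    (z - w) / (z - w') ∈ slitPlane := by
  have h0 : z - w' ≠ 0 := norm_pos_iff.1 ((norm_nonneg _).trans_lt h)
  have : (z - w) / (z - w') = 1 + (w' - w) / (z - w') := by field_simp; ring
  rw [this]
  apply Complex.mem_slitPlane_of_norm_lt_one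
  rw [norm_div, norm_sub_rev w' w, div_lt_one (norm_pos_iff.2 h0)]
  exact h

lemma tendsto_ratio {γ : ℝ → ℂ} {l : Filter ℝ} (h : Tendsto (fun t => ‖γ t‖) l atTop) (w w' : ℂ) :
    Tendsto (fun t => (γ t - w) / (γ t - w')) l (𝓝 1) := by
  have h1 : Tendsto (fun t => γ t - w') l (Bornology.cobounded ℂ) := by
    rw [← tendsto_norm_atTop_iff_cobounded]
    refine tendsto_atTop_mono (fun t => ?_) (tendsto_atTop_add_const_right l (-‖w'‖) h)
    have := norm_sub_norm_le (γ t) w'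
    linarith
  have h2 : Tendsto (fun t => (γ t - w')⁻¹) l (𝓝 0) := tendsto_inv₀_cobounded.comp h1
  have h3 : Tendsto (fun t => 1 + (w' - w) * (γ t - w')⁻¹) l (𝓝 1) := by
    simpa using (h2.const_mul (w' - w)).const_add 1
  refine h3.congr' ?_
  filter_upwards [h1.eventually (Bornology.eventually_ne_cobounded 0)] with t ht
  field_simp
  ring

lemma hasRelativeWindingNumber_zero_of_near {γ : ℝ → ℂ} (hγ : Continuous γ)
    (hlim : Tendsto (fun τ => ‖γ τ‖) (atBot ⊔ atTop) atTop) {w w' : ℂ}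
    (h : ∀ t, ‖w - w'‖ < ‖γ t - w'‖) : HasRelativeWindingNumber γ w w' 0 := by
  have hne : ∀ t, γ t - w' ≠ 0 := fun t => norm_pos_iff.1 ((norm_nonneg _).trans_lt (h t))
  have hlog : Tendsto Complex.log (𝓝 1) (𝓝 0) := by
    simpa using (continuousAt_clog one_mem_slitPlane).tendsto
  refine ⟨fun t => Complex.log ((γ t - w) / (γ t - w')), ?_, fun t => ?_, ?_, ?_⟩
  · exact ((hγ.sub continuous_const).div (hγ.sub continuous_const) hne).clog
      fun t => div_mem_slitPlane (h t)
  · exact Complex.exp_log (slitPlane_ne_zero (div_mem_slitPlane (h t)))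
  · exact hlog.comp (tendsto_ratio (hlim.mono_left le_sup_left) w w')
  · simpa [Function.comp_def] using
      hlog.comp (tendsto_ratio (hlim.mono_left le_sup_right) w w')

/-- Off `Ioo a b` the ratio stays in the slit plane, so there the principal logarithm is a
continuous branch on both tails and vanishes at both ends. It equals the lift on the left tail and
differs from it by `2πi n` on the right one: all the winding happens on the arc over `[a, b]`. -/
lemma HasRelativeWindingNumber.exists_lift {γ : ℝ → ℂ} (hγ : Continuous γ)
    (hlim : Tendsto (fun τ => ‖γ τ‖) (atBot ⊔ atTop) atTop) {w w' : ℂ} {n : ℤ} {a b : ℝ}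
    (hn : HasRelativeWindingNumber γ w w' n)
    (h : ∀ t ∉ Ioo a b, ‖w - w'‖ < ‖γ t - w'‖) :
    ∃ θ : ℝ → ℂ, Continuous θ ∧ (∀ t, Complex.exp (θ t) = (γ t - w) / (γ t - w')) ∧
      θ b - θ a = 2 * Real.pi * Complex.I * n + Complex.log ((γ b - w) / (γ b - w')) -
        Complex.log ((γ a - w) / (γ a - w')) := by
  obtain ⟨θ, h1, h2, h3, h4⟩ := hn
  have hlog : Tendsto Complex.log (𝓝 1) (𝓝 0) := by
    simpa using (continuousAt_clog one_mem_slitPlane).tendsto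
  set ψ : ℝ → ℂ := fun t => Complex.log ((γ t - w) / (γ t - w')) with hψ
  have hcont : ∀ S : Set ℝ, (∀ t ∈ S, t ∉ Ioo a b) → ContinuousOn ψ S := by
    intro S hS
    have hne : ∀ t ∈ S, γ t - w' ≠ 0 := fun t ht =>
      norm_pos_iff.1 ((norm_nonneg _).trans_lt (h t (hS t ht)))
    exact ContinuousOn.clog ((hγ.sub continuous_const).continuousOn.div
      (hγ.sub continuous_const).continuousOn hne) fun t ht => div_mem_slitPlane (h t (hS t ht))
  have hexp : ∀ t ∉ Ioo a b, Complex.exp (θ t) = Complex.exp (ψ t) := fun t ht => by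
    rw [h2, hψ, Complex.exp_log (slitPlane_ne_zero (div_mem_slitPlane (h t ht)))]
  have hA : θ a - ψ a = 0 := by
    have e : (fun _ => θ a - ψ a) =ᶠ[atBot] fun t => θ t - ψ t := by
      filter_upwards [eventually_le_atBot a] with t ht
      have := sub_eq_sub_of_exp_eq (S := Iic a) isPreconnected_Iic h1.continuousOn
        (hcont _ fun t ht ht' => absurd ht'.1 (not_lt.2 ht))
        (fun t ht => hexp t fun ht' => absurd ht'.1 (not_lt.2 ht)) (mem_Iic.2 ht)
        (mem_Iic.2 le_rfl)
      linear_combination this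
    have l : Tendsto (fun t => θ t - ψ t) atBot (𝓝 (0 - 0)) :=
      h3.sub (hlog.comp (tendsto_ratio (hlim.mono_left le_sup_left) w w'))
    rw [sub_zero] at l
    exact tendsto_nhds_unique (tendsto_const_nhds.congr' e) l
  have hB : θ b - ψ b = 2 * Real.pi * Complex.I * n := by
    have e : (fun _ => θ b - ψ b) =ᶠ[atTop] fun t => θ t - ψ t := by
      filter_upwards [eventually_ge_atTop b] with t ht
      have := sub_eq_sub_of_exp_eq (S := Ici b) isPreconnected_Ici h1.continuousOn
        (hcont _ fun t ht ht' => absurd ht'.2 (not_lt.2 ht))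
        (fun t ht => hexp t fun ht' => absurd ht'.2 (not_lt.2 ht)) (mem_Ici.2 le_rfl)
        (mem_Ici.2 ht)
      linear_combination -this
    have l : Tendsto (fun t => θ t - ψ t) atTop (𝓝 (2 * Real.pi * Complex.I * n - 0)) :=
      h4.sub (hlog.comp (tendsto_ratio (hlim.mono_left le_sup_right) w w'))
    rw [sub_zero] at l
    exact tendsto_nhds_unique (tendsto_const_nhds.congr' e) l
  exact ⟨θ, h1, h2, by linear_combination hB - hA⟩

/-! ### Proper injective curves -/

lemma isProperMap_of_tendsto {γ : ℝ → ℂ} (hγ : Continuous γ)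
    (hlim : Tendsto (fun τ => ‖γ τ‖) (atBot ⊔ atTop) atTop) : IsProperMap γ := by
  rw [isProperMap_iff_tendsto_cocompact]
  refine ⟨hγ, ?_⟩
  rw [cocompact_eq_atBot_atTop, ← Metric.cobounded_eq_cocompact,
    ← tendsto_norm_atTop_iff_cobounded]
  exact hlim

lemma isClosed_image_of_tendsto {γ : ℝ → ℂ} (hγ : Continuous γ)
    (hlim : Tendsto (fun τ => ‖γ τ‖) (atBot ⊔ atTop) atTop) {S : Set ℝ} (hS : IsClosed S) :
    IsClosed (γ '' S) :=
  (isProperMap_of_tendsto hγ hlim).isClosedMap _ hS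

lemma isClosed_range_of_tendsto {γ : ℝ → ℂ} (hγ : Continuous γ)
    (hlim : Tendsto (fun τ => ‖γ τ‖) (atBot ⊔ atTop) atTop) : IsClosed (range γ) := by
  rw [← image_univ]
  exact isClosed_image_of_tendsto hγ hlim isClosed_univ

lemma exists_dist_le_of_notMem {S : Set ℝ} {γ : ℝ → ℂ} (h : IsClosed (γ '' S)) {z : ℂ}
    (hz : z ∉ γ '' S) : ∃ ρ > 0, ∀ t ∈ S, ρ ≤ ‖γ t - z‖ := by
  obtain ⟨ρ, hρ, hb⟩ := Metric.isOpen_iff.1 h.isOpen_compl z hz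
  refine ⟨ρ, hρ, fun t ht => ?_⟩
  by_contra! hlt
  exact hb (mem_ball_iff_norm.2 hlt) ⟨t, ht, rfl⟩

/-- Away from `Ioo a b`, an injective proper curve keeps a positive distance from `γ t₀`. -/
lemma exists_dist_le_compl_Ioo {γ : ℝ → ℂ} (hγ : Continuous γ) (hinj : Function.Injective γ)
    (hlim : Tendsto (fun τ => ‖γ τ‖) (atBot ⊔ atTop) atTop) {a b t₀ : ℝ} (ht : t₀ ∈ Ioo a b) :
    ∃ ρ > 0, ∀ t ∉ Ioo a b, ρ ≤ ‖γ t - γ t₀‖ := by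
  obtain ⟨ρ, hρ, h⟩ := exists_dist_le_of_notMem
    (isClosed_image_of_tendsto hγ hlim (isOpen_Ioo (a := a) (b := b)).isClosed_compl) (z := γ t₀)
    (by rintro ⟨t, h1, h2⟩; exact h1 (hinj h2 ▸ ht))
  exact ⟨ρ, hρ, h⟩

/-- The break points of a piecewise smooth curve form a countable set. -/
lemma IsPiecewiseSmooth.exists_countable {γ : ℝ → ℂ} (h : IsPiecewiseSmooth γ) :
    ∃ E : Set ℝ, E.Countable ∧ ∀ t ∉ E, DifferentiableAt ℝ γ t := by
  obtain ⟨hc, E, hE, hs⟩ := h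
  refine ⟨E, ?_, fun t ht => ?_⟩
  · have : E = ⋃ n : ℕ, E ∩ Icc (-(n : ℝ)) n := by
      ext x
      simp only [mem_iUnion, mem_inter_iff, mem_Icc]
      refine ⟨fun hx => ?_, fun ⟨_, hx, _⟩ => hx⟩
      obtain ⟨n, hn⟩ := exists_nat_ge |x|
      exact ⟨n, hx, abs_le.1 hn⟩
    rw [this]
    exact countable_iUnion fun n => (hE n).countable
  · have hcl : IsClosed (E ∩ Icc (-(|t| + 1)) (|t| + 1)) := (hE _).isClosed
    obtain ⟨ε, hε, hb⟩ := Metric.isOpen_iff.1 hcl.isOpen_compl t fun h => ht h.1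
    set η := min (ε / 2) 1
    have hη : 0 < η := by positivity
    have h1 : η ≤ ε / 2 := min_le_left _ _
    have h2 : η ≤ 1 := min_le_right _ _
    have := hs (t - η) (t + η) (by linarith) (by
      rw [Set.disjoint_left]
      intro x hx hxE
      refine hb (a := x) ?_ ⟨hxE, ?_⟩
      · rw [Metric.mem_ball, Real.dist_eq, abs_lt]
        constructor <;> linarith [hx.1, hx.2]
      · constructor <;> linarith [hx.1, hx.2, neg_abs_le t, le_abs_self t])
    exact (this.contDiffAt (Icc_mem_nhds (by linarith) (by linarith))).differentiableAt (by norm_num)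

/-! ### A proper injective piecewise smooth curve separates the plane -/

/-- Otherwise the derivative vanishes off a countable set and `γ` is constant. -/
lemma IsPiecewiseSmooth.exists_hasDerivAt_ne_zero {γ : ℝ → ℂ} (h : IsPiecewiseSmooth γ)
    (hinj : Function.Injective γ) : ∃ t₀ v, v ≠ 0 ∧ HasDerivAt γ v t₀ := by
  obtain ⟨E, hE, hd⟩ := h.exists_countable
  by_contra! hcon
  have h0 : ∀ t ∉ E, HasDerivAt γ 0 t := fun t ht => by
    have h1 := (hd t ht).hasDerivAt
    by_cases h2 : deriv γ t = 0
    · rwa [h2] at h1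
    · exact absurd h1 (hcon t _ h2)
  have := integral_eq_of_hasDerivAt_off_countable γ (fun _ => (0 : ℂ)) (a := 0) (b := 1) hE
    h.1.continuousOn (fun t ht => h0 t ht.2) (by simp)
  have h2 : γ 1 = γ 0 := sub_eq_zero.1 (by simpa using this.symm)
  exact one_ne_zero (hinj h2)

/-- In the coordinate `(γ - γ t₀) / v` the arc near `t₀` meets the imaginary axis only at the
origin, passing from left to right. -/
lemma re_pos_of_hasDerivAt {γ : ℝ → ℂ} {t₀ : ℝ} {v : ℂ} (hv : v ≠ 0) (h : HasDerivAt γ v t₀) :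
    ∃ η > 0, ∀ t, |t - t₀| ≤ η → |((γ t - γ t₀) / v).re - (t - t₀)| ≤ |t - t₀| / 2 := by
  have h1 := (hasDerivAt_iff_isLittleO.1 h).bound (c := ‖v‖ / 2) (by positivity)
  obtain ⟨η, hη, hb⟩ := Metric.nhds_basis_closedBall.mem_iff.1 h1
  refine ⟨η, hη, fun t ht => ?_⟩
  have h2 : ‖γ t - γ t₀ - (t - t₀) • v‖ ≤ ‖v‖ / 2 * ‖t - t₀‖ := hb (by
    rwa [Metric.mem_closedBall, Real.dist_eq])
  have h3 : ((γ t - γ t₀) / v).re - (t - t₀) = ((γ t - γ t₀ - (t - t₀) • v) / v).re := by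
    rw [sub_div _ ((t - t₀) • v), Complex.real_smul, mul_div_cancel_right₀ _ hv, Complex.sub_re,
      Complex.ofReal_re]
  rw [h3]
  refine (Complex.abs_re_le_norm _).trans ?_
  rw [norm_div, div_le_iff₀ (norm_pos_iff.2 hv)]
  rw [Real.norm_eq_abs] at h2
  linarith

lemma log_sub_log_neg_of_im_pos {z : ℂ} (hz : 0 < z.im) :
    Complex.log z - Complex.log (-z) = Real.pi * Complex.I := by
  simp only [Complex.log, norm_neg, Complex.arg_neg_eq_arg_sub_pi_of_im_pos hz]
  push_cast; ring

/-- On a connected complement all relative winding numbers vanish, since they do for nearby points.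
But take the two points `γ t₀ ± iεv` on either side of a point with derivative `v ≠ 0`. The
logarithm of the ratio of the distances changes along the arc near `t₀` by an amount tending to
`2πi` as `ε → 0`, while winding number zero forces it to tend to `0`. -/
theorem not_isPreconnected_compl_range {γ : ℝ → ℂ} (h : IsPiecewiseSmooth γ)
    (hinj : Function.Injective γ) (hlim : Tendsto (fun τ => ‖γ τ‖) (atBot ⊔ atTop) atTop) :
    ¬ IsPreconnected (range γ)ᶜ := by
  intro hconn
  have hγ := h.1
  have hzero : ∀ w w', w ∉ range γ → w' ∉ range γ → HasRelativeWindingNumber γ w w' 0 := by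
    intro w w' hw hw'
    refine hconn.induction₂ (fun w w' => HasRelativeWindingNumber γ w w' 0) ?_ ?_ ?_ hw hw'
    · intro x hx
      obtain ⟨ρ, hρ, hd⟩ := exists_dist_le_of_notMem (S := univ) (γ := γ) (z := x)
        (isClosed_image_of_tendsto hγ hlim isClosed_univ) (by rwa [image_univ])
      refine mem_nhdsWithin_of_mem_nhds ?_
      filter_upwards [Metric.ball_mem_nhds x hρ] with y hy
      have := hasRelativeWindingNumber_zero_of_near hγ hlim (w := y) (w' := x)
        fun t => (mem_ball_iff_norm.1 hy).trans_le (hd t trivial)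
      simpa using this.symm
    · intro x y z _ hy _ h1 h2
      simpa using h1.trans h2 hy
    · intro x y _ _ h1
      simpa using h1.symm
  obtain ⟨t₀, v, hv, hder⟩ := h.exists_hasDerivAt_ne_zero hinj
  obtain ⟨η, hη, hre⟩ := re_pos_of_hasDerivAt hv hder
  set a := t₀ - η with ha
  set b := t₀ + η with hb
  have habt : t₀ ∈ Ioo a b := ⟨by linarith, by linarith⟩
  set u : ℝ → ℂ := fun t => (γ t - γ t₀) / v with hu
  have hγu : ∀ t, γ t = γ t₀ + u t * v := fun t => by simp only [hu]; field_simp; ring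
  have hpos : ∀ t ∈ Icc a b, t₀ < t → 0 < (u t).re := fun t ht h1 => by
    have := hre t (by rw [abs_le]; constructor <;> linarith [ht.1, ht.2])
    rw [abs_of_pos (sub_pos.2 h1), abs_le] at this
    simp only [hu]; linarith
  have hneg : ∀ t ∈ Icc a b, t < t₀ → (u t).re < 0 := fun t ht h1 => by
    have := hre t (by rw [abs_le]; constructor <;> linarith [ht.1, ht.2])
    rw [abs_of_neg (sub_neg.2 h1), abs_le] at this
    simp only [hu]; linarith
  have hut : u t₀ = 0 := by simp [hu]
  have hucont : Continuous u := (hγ.sub continuous_const).div_const _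
  obtain ⟨ρ, hρ, hfar⟩ := exists_dist_le_compl_Ioo hγ hinj hlim habt
  have hvn : 0 < ‖v‖ := norm_pos_iff.2 hv
  -- The imaginary parts are `± Re (u t)`, nonzero for `t ≠ t₀`; at `t₀` both numbers equal `ε > 0`.
  have hslit : ∀ ε : ℝ, 0 < ε → ∀ t ∈ Icc a b, Complex.I * u t + ε ∈ slitPlane ∧
      -(Complex.I * u t) + ε ∈ slitPlane := by
    intro ε hε t ht
    rcases lt_trichotomy t t₀ with h1 | h1 | h1
    · have := hneg t ht h1
      constructor <;> right <;> simp [this.ne]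
    · rw [h1, hut]
      constructor <;> left <;> simp [hε]
    · have := hpos t ht h1
      constructor <;> right <;> simp [this.ne']
  have hwoff : ∀ s : ℝ, s ≠ 0 → |s| * ‖v‖ < ρ → γ t₀ + s * Complex.I * v ∉ range γ := by
    rintro s hs hsρ ⟨t, ht⟩
    have ht' : u t = s * Complex.I := by
      rw [hγu t] at ht
      exact mul_right_cancel₀ hv (add_left_cancel ht)
    by_cases hI : t ∈ Ioo a b
    · have hr : (u t).re = 0 := by rw [ht']; simp
      rcases lt_trichotomy t t₀ with h1 | h1 | h1
      · exact (hneg t (Ioo_subset_Icc_self hI) h1).ne hr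
      · rw [h1, hut] at ht'
        exact hs (by simpa using ht'.symm)
      · exact (hpos t (Ioo_subset_Icc_self hI) h1).ne' hr
    · have := hfar t hI
      rw [hγu t, add_sub_cancel_left, ht'] at this
      simp at this
      linarith
  set q : ℝ → ℝ → ℂ := fun t ε => (γ t - (γ t₀ + ε * Complex.I * v)) /
    (γ t - (γ t₀ - ε * Complex.I * v)) with hq
  -- The same change of logarithm over `[a, b]`, computed by an explicit branch on the arc (left)
  -- and through the tails (right). The factor `3` in `3ε‖v‖ < ρ` makes the distance `2ε‖v‖` of the
  -- two points smaller than `ρ - ε‖v‖`.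
  have hmain : ∀ ε : ℝ, 0 < ε → 3 * ε * ‖v‖ < ρ →
      (Complex.log (Complex.I * u b + ε) - Complex.log (-(Complex.I * u b) + ε)) -
      (Complex.log (Complex.I * u a + ε) - Complex.log (-(Complex.I * u a) + ε)) =
      Complex.log (q b ε) - Complex.log (q a ε) := by
    intro ε hε hερ
    have hp := hwoff ε hε.ne' (by rw [abs_of_pos hε]; nlinarith)
    have hm := hwoff (-ε) (by linarith) (by rw [abs_neg, abs_of_pos hε]; nlinarith)
    have hm' : γ t₀ + ((-ε : ℝ) : ℂ) * Complex.I * v = γ t₀ - ε * Complex.I * v := by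
      push_cast; ring
    rw [hm'] at hm
    obtain ⟨θ, hθ, hexp, hθab⟩ := (hzero _ _ hp hm).exists_lift hγ hlim (a := a) (b := b) (by
      intro t ht
      have h1 := hfar t ht
      have h2 : ‖γ t - γ t₀‖ ≤ ‖γ t - (γ t₀ - ε * Complex.I * v)‖ + ‖ε * Complex.I * v‖ := by
        refine le_of_eq_of_le (congrArg norm ?_)
          (norm_sub_le (γ t - (γ t₀ - ε * Complex.I * v)) (ε * Complex.I * v))
        ring
      have h3 : ‖γ t₀ + ε * Complex.I * v - (γ t₀ - ε * Complex.I * v)‖ = 2 * (ε * ‖v‖) := by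
        rw [show γ t₀ + ε * Complex.I * v - (γ t₀ - ε * Complex.I * v) = 2 * (ε * Complex.I * v) by
          ring]
        simp [abs_of_pos hε]
      have h4 : ‖ε * Complex.I * v‖ = ε * ‖v‖ := by simp [abs_of_pos hε]
      rw [h3]; linarith)
    have hcont : ContinuousOn (fun t => Complex.log (Complex.I * u t + ε) -
        Complex.log (-(Complex.I * u t) + ε) + Real.pi * Complex.I) (Icc a b) := by
      refine ((ContinuousOn.clog (by fun_prop) fun t ht => (hslit ε hε t ht).1).sub
        (ContinuousOn.clog (by fun_prop) fun t ht => (hslit ε hε t ht).2)).add continuousOn_const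
    have := sub_eq_sub_of_exp_eq isPreconnected_Icc hθ.continuousOn hcont (by
      intro t ht
      have s1 := slitPlane_ne_zero (hslit ε hε t ht).1
      have s2 := slitPlane_ne_zero (hslit ε hε t ht).2
      rw [hexp, Complex.exp_add, Complex.exp_sub, Complex.exp_log s1, Complex.exp_log s2,
        Complex.exp_pi_mul_I, hγu t]
      have e1 : γ t₀ + u t * v - (γ t₀ + ε * Complex.I * v) =
          -(Complex.I * v) * (Complex.I * u t + ε) := by
        linear_combination (u t * v) * Complex.I_sq
      have e2 : γ t₀ + u t * v - (γ t₀ - ε * Complex.I * v) =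
          (Complex.I * v) * (-(Complex.I * u t) + ε) := by
        linear_combination (u t * v) * Complex.I_sq
      rw [e1, e2]
      have := Complex.I_ne_zero
      field_simp)
      (left_mem_Icc.2 (by linarith)) (right_mem_Icc.2 (by linarith))
    rw [hθab] at this
    simp only [hq]
    push_cast at this
    linear_combination -this
  have hua := hneg a ⟨le_rfl, by linarith⟩ (by linarith)
  have hub := hpos b ⟨by linarith, le_rfl⟩ (by linarith)
  have hofr : Tendsto (fun ε : ℝ => (ε : ℂ)) (𝓝[>] 0) (𝓝 0) := by
    have := (Complex.continuous_ofReal.tendsto 0).mono_left (nhdsWithin_le_nhds (s := Ioi 0))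
    simpa using this
  have hl : ∀ c : ℂ, c.im ≠ 0 → Tendsto (fun ε : ℝ => Complex.log (c + ε)) (𝓝[>] 0)
      (𝓝 (Complex.log c)) := fun c hc => by
    have := hofr.const_add c
    rw [add_zero] at this
    exact this.clog (Or.inr hc)
  have hqt : ∀ t, γ t ≠ γ t₀ → Tendsto (fun ε : ℝ => Complex.log (q t ε)) (𝓝[>] 0) (𝓝 0) := by
    intro t ht
    have h0 : γ t - γ t₀ ≠ 0 := sub_ne_zero.2 ht
    have h1 : Tendsto (fun ε : ℝ => q t ε) (𝓝[>] 0)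
        (𝓝 ((γ t - (γ t₀ + 0 * Complex.I * v)) / (γ t - (γ t₀ - 0 * Complex.I * v)))) := by
      refine Tendsto.div ?_ ?_ (by simpa using h0)
      · exact tendsto_const_nhds.sub (((hofr.mul_const _).mul_const _).const_add _)
      · exact tendsto_const_nhds.sub (((hofr.mul_const _).mul_const _).const_sub _)
    simp only [zero_mul, add_zero, sub_zero, div_self h0] at h1
    simpa using h1.clog one_mem_slitPlane
  have L1 := ((hl (Complex.I * u b) (by simpa using hub.ne')).sub
    (hl (-(Complex.I * u b)) (by simpa using hub.ne'))).sub
    ((hl (Complex.I * u a) (by simpa using hua.ne)).sub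
    (hl (-(Complex.I * u a)) (by simpa using hua.ne)))
  have L2 := (hqt b (fun h => by have := hinj h; linarith)).sub
    (hqt a (fun h => by have := hinj h; linarith))
  have hev : ∀ᶠ ε : ℝ in 𝓝[>] 0, 0 < ε ∧ 3 * ε * ‖v‖ < ρ := by
    have : ∀ᶠ ε : ℝ in 𝓝 0, 3 * ε * ‖v‖ < ρ := by
      have : Tendsto (fun ε : ℝ => 3 * ε * ‖v‖) (𝓝 0) (𝓝 (3 * 0 * ‖v‖)) :=
        Continuous.tendsto (by fun_prop) 0
      exact this.eventually_lt_const (by simpa using hρ)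
    filter_upwards [self_mem_nhdsWithin, nhdsWithin_le_nhds this] with ε h1 h2
    exact ⟨h1, h2⟩
  have := tendsto_nhds_unique L1 (L2.congr' (by
    filter_upwards [hev] with ε h1
    exact (hmain ε h1.1 h1.2).symm))
  -- The limit on the arc side is `πi - (-πi)`, because `Re (u b) > 0 > Re (u a)`.
  have j1 := log_sub_log_neg_of_im_pos (z := Complex.I * u b) (by simpa using hub)
  have j2 := log_sub_log_neg_of_im_pos (z := -(Complex.I * u a)) (by simpa using hua)
  rw [neg_neg] at j2
  refine Complex.two_pi_I_ne_zero ?_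
  linear_combination this - j1 - j2

/-! ### Logarithms as integrals -/

/-- By continuity `Im (θ s - θ t)` stays in `(-π, π)` near `t`, so `θ` is locally a constant plus
the principal logarithm of `q s / q t`. -/
lemma hasDerivAt_of_exp_eq {θ q : ℝ → ℂ} {q' : ℂ} {t : ℝ} (hθ : ContinuousAt θ t)
    (he : ∀ s, Complex.exp (θ s) = q s) (hq : HasDerivAt q q' t) :
    HasDerivAt θ (q' / q t) t := by
  have hqt : q t ≠ 0 := he t ▸ Complex.exp_ne_zero _
  have h1 : HasDerivAt (fun s => θ t + Complex.log (q s / q t)) (q' / q t) t := by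
    have := (hq.div_const (q t)).clog_real (by rw [div_self hqt]; exact one_mem_slitPlane)
    rw [div_self hqt, div_one] at this
    exact this.const_add _
  refine h1.congr_of_eventuallyEq ?_
  have h2 : Tendsto (fun s => (θ s - θ t).im) (𝓝 t) (𝓝 0) := by
    have := (Complex.continuous_im.tendsto _).comp (hθ.tendsto.sub_const (θ t))
    simpa [Function.comp_def] using this
  filter_upwards [h2.eventually_lt_const Real.pi_pos,
    h2.eventually_const_lt (neg_lt_zero.2 Real.pi_pos)] with s hs1 hs2
  rw [← he s, ← he t, ← Complex.exp_sub, Complex.log_exp hs2 hs1.le]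
  ring

lemma lift_sub_eq_integral {γ θ : ℝ → ℂ} (h : IsPiecewiseSmooth γ) (hθ : Continuous θ) {w w' : ℂ}
    (hw : w ∉ range γ) (hw' : w' ∉ range γ)
    (he : ∀ t, Complex.exp (θ t) = (γ t - w) / (γ t - w')) {a b : ℝ}
    (hint : IntervalIntegrable (deriv γ) volume a b) :
    θ b - θ a = (∫ t in a..b, (γ t - w)⁻¹ * deriv γ t) - ∫ t in a..b, (γ t - w')⁻¹ * deriv γ t := by
  obtain ⟨E, hE, hd⟩ := h.exists_countable
  have h0 : ∀ t, γ t - w ≠ 0 := fun t => sub_ne_zero.2 fun h => hw ⟨t, h⟩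
  have h0' : ∀ t, γ t - w' ≠ 0 := fun t => sub_ne_zero.2 fun h => hw' ⟨t, h⟩
  have hγ := h.1
  have i1 : IntervalIntegrable (fun t => (γ t - w)⁻¹ * deriv γ t) volume a b :=
    hint.continuousOn_mul ((hγ.sub continuous_const).inv₀ h0).continuousOn
  have i2 : IntervalIntegrable (fun t => (γ t - w')⁻¹ * deriv γ t) volume a b :=
    hint.continuousOn_mul ((hγ.sub continuous_const).inv₀ h0').continuousOn
  rw [← intervalIntegral.integral_sub i1 i2]
  refine (integral_eq_of_hasDerivAt_off_countable θ _ hE hθ.continuousOn (fun t ht => ?_)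
    (i1.sub i2)).symm
  have hg := (hd t ht.2).hasDerivAt
  have := h0 t
  have := h0' t
  refine (hasDerivAt_of_exp_eq hθ.continuousAt he
    ((hg.sub_const w).fun_div (hg.sub_const w') (h0' t))).congr_deriv ?_
  field_simp

open Classical in
/-- The relative winding numbers in terms of the characteristic function of the component. -/
lemma RunsClockwiseAround.hasRelativeWindingNumber {γ : ℝ → ℂ} (h : IsPiecewiseSmooth γ)
    (hinj : Function.Injective γ) (hlim : Tendsto (fun τ => ‖γ τ‖) (atBot ⊔ atTop) atTop)
    {U : Set ℂ} (hU : IsComponentOf U (range γ)ᶜ) (hr : RunsClockwiseAround γ U) {w w' : ℂ}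
    (hw : w ∉ range γ) (hw' : w' ∉ range γ) :
    HasRelativeWindingNumber γ w w' ((if w' ∈ U then 1 else 0) - (if w ∈ U then 1 else 0)) := by
  obtain ⟨z₀, hz₀, rfl⟩ := hU
  have hz₀U := mem_connectedComponentIn hz₀
  -- An outside point, through which two points of the component are compared. Two outside points
  -- are compared through `z₀`.
  obtain ⟨w₂, hw₂, hw₂U⟩ : ∃ w₂ ∈ (range γ)ᶜ, w₂ ∉ connectedComponentIn (range γ)ᶜ z₀ := by
    by_contra! hcon
    apply not_isPreconnected_compl_range h hinj hlim
    rw [← (connectedComponentIn_subset (range γ)ᶜ z₀).antisymm hcon]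
    exact isPreconnected_connectedComponentIn
  by_cases h1 : w ∈ connectedComponentIn (range γ)ᶜ z₀ <;>
    by_cases h2 : w' ∈ connectedComponentIn (range γ)ᶜ z₀
  · simpa [h1, h2] using (hr w h1 w₂ hw₂U hw₂).trans (hr w' h2 w₂ hw₂U hw₂).symm hw₂
  · simpa [h1, h2] using hr w h1 w' h2 hw'
  · simpa [h1, h2] using (hr w' h2 w h1 hw).symm
  · simpa [h1, h2] using (hr z₀ hz₀U w h1 hw).symm.trans (hr z₀ hz₀U w' h2 hw') hz₀

/-- Across a point of the curve, the local logarithmic integral extends holomorphically after its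
jump has been removed. -/
lemma exists_local_log {γ : ℝ → ℂ} (h : IsPiecewiseSmooth γ)
    (hlim : Tendsto (fun τ => ‖γ τ‖) (atBot ⊔ atTop) atTop) {χ : ℂ → ℤ}
    (hχ : ∀ w w', w ∉ range γ → w' ∉ range γ → HasRelativeWindingNumber γ w w' (χ w' - χ w))
    {a b ρ : ℝ} {ζ : ℂ} (hfar : ∀ t ∉ Ioo a b, ρ ≤ ‖γ t - ζ‖)
    (hint : IntervalIntegrable (deriv γ) volume a b) :
    ∃ Λ : ℂ → ℂ, DifferentiableOn ℂ Λ (Metric.ball ζ (ρ / 3)) ∧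
      ∀ w ∈ Metric.ball ζ (ρ / 3), w ∉ range γ →
        Λ w = (∫ t in a..b, (γ t - w)⁻¹ * deriv γ t) + 2 * Real.pi * Complex.I * χ w := by
  by_cases hex : ∃ w' ∈ Metric.ball ζ (ρ / 3), w' ∉ range γ
  swap
  · push Not at hex
    exact ⟨0, differentiableOn_const 0, fun w hw hw' => absurd (hex w hw) hw'⟩
  obtain ⟨w', hw'b, hw'⟩ := hex
  have hnear : ∀ w ∈ Metric.ball ζ (ρ / 3), ∀ t ∉ Ioo a b, ‖w - w'‖ < ‖γ t - w'‖ := by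
    intro w hw t ht
    have h1 := hfar t ht
    rw [mem_ball_iff_norm] at hw hw'b
    have h2 : ‖w - w'‖ ≤ ‖w - ζ‖ + ‖w' - ζ‖ := by
      simpa using norm_sub_le (w - ζ) (w' - ζ)
    have h3 : ‖γ t - ζ‖ ≤ ‖γ t - w'‖ + ‖w' - ζ‖ := by
      simpa using norm_add_le (γ t - w') (w' - ζ)
    linarith
  have hlog : ∀ t ∉ Ioo a b, DifferentiableOn ℂ
      (fun w => Complex.log ((γ t - w) / (γ t - w'))) (Metric.ball ζ (ρ / 3)) := fun t ht =>
    DifferentiableOn.clog (by fun_prop) fun w hw => div_mem_slitPlane (hnear w hw t ht)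
  have ha : a ∉ Ioo a b := fun h => lt_irrefl _ h.1
  have hb : b ∉ Ioo a b := fun h => lt_irrefl _ h.2
  -- The lift changes over `[a, b]` both by the difference of the logarithmic integrals at `w` and
  -- `w'` and by the amount given by `exists_lift`. Solving for the integral at `w` plus `2πi χ w`
  -- leaves an expression that is holomorphic on the whole disc.
  refine ⟨fun w => (∫ t in a..b, (γ t - w')⁻¹ * deriv γ t) + 2 * Real.pi * Complex.I * χ w' +
    Complex.log ((γ b - w) / (γ b - w')) - Complex.log ((γ a - w) / (γ a - w')),
    (((differentiableOn_const _).add (hlog b hb)).sub (hlog a ha)), fun w hw hwγ => ?_⟩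
  obtain ⟨θ, h1, h2, h3⟩ := (hχ w w' hwγ hw').exists_lift h.1 hlim (hnear w hw)
  rw [lift_sub_eq_integral h h1 hwγ hw' h2 hint] at h3
  push_cast at h3 ⊢
  linear_combination -h3

/-! ### Integrals that depend holomorphically on a parameter -/

/-- Cauchy's estimate turns a bound for `F` into one for its `w`-derivative on a smaller disc, so
dominating `F` itself is enough. -/
theorem differentiableOn_integral_of_dominated {α : Type*} [MeasurableSpace α] {μ : Measure α}
    {F : ℂ → α → ℂ} {U : Set ℂ} (hU : IsOpen U) {bound : α → ℝ}
    (hmeas : ∀ w ∈ U, AEStronglyMeasurable (F w) μ)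
    (hdiff : ∀ᵐ t ∂μ, DifferentiableOn ℂ (fun w => F w t) U) (hbound : Integrable bound μ)
    (hle : ∀ᵐ t ∂μ, ∀ w ∈ U, ‖F w t‖ ≤ bound t) :
    DifferentiableOn ℂ (fun w => ∫ t, F w t ∂μ) U := by
  intro z hz
  obtain ⟨ε, hε, hb⟩ := Metric.isOpen_iff.1 hU z hz
  set r := ε / 2 with hr
  have hrpos : 0 < r := by positivity
  have hderiv : ∀ᵐ t ∂μ, ∀ w ∈ Metric.ball z r,
      HasDerivAt (fun w => F w t) (deriv (fun w => F w t) w) w := by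
    filter_upwards [hdiff] with t ht w hw
    exact (ht.differentiableAt (hU.mem_nhds
      (hb (Metric.ball_subset_ball (by linarith) hw)))).hasDerivAt
  have hderiv_le : ∀ᵐ t ∂μ, ∀ w ∈ Metric.ball z r,
      ‖deriv (fun w => F w t) w‖ ≤ bound t / (r / 2) := by
    filter_upwards [hdiff, hle] with t ht htle w hw
    have hsub : Metric.closedBall w (r / 2) ⊆ U := fun x hx => hb (by
      rw [Metric.mem_ball] at hw ⊢
      rw [Metric.mem_closedBall] at hx
      have := dist_triangle x w z
      linarith)
    refine Complex.norm_deriv_le_of_forall_mem_sphere_norm_le (by positivity) ?_ fun x hx =>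
      htle x (hsub (Metric.sphere_subset_closedBall hx))
    refine (ht.mono ?_).diffContOnCl
    exact (closure_mono Metric.ball_subset_closedBall).trans
      (Metric.isClosed_closedBall.closure_eq.subset.trans hsub)
  have hseq : ∀ n : ℕ, z + ((r / (n + 1) : ℝ) : ℂ) ∈ U := fun n => hb (by
    rw [mem_ball_iff_norm, add_sub_cancel_left, Complex.norm_real, Real.norm_of_nonneg (by positivity)]
    have : r / (n + 1) ≤ r := div_le_self hrpos.le (by linarith [n.cast_nonneg (α := ℝ)])
    linarith)
  -- The derivative is a limit of measurable difference quotients along `z + r / (n + 1)`.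
  have hmeas' : AEStronglyMeasurable (fun t => deriv (fun w => F w t) z) μ := by
    refine aestronglyMeasurable_of_tendsto_ae atTop (f := fun (n : ℕ) t =>
      ((r / (n + 1) : ℝ) : ℂ)⁻¹ • (F (z + ((r / (n + 1) : ℝ) : ℂ)) t - F z t))
      (fun n => AEStronglyMeasurable.const_smul ((hmeas _ (hseq n)).sub (hmeas z hz))
        ((r / (n + 1) : ℝ) : ℂ)⁻¹) ?_
    filter_upwards [hderiv] with t ht
    have h1 := hasDerivAt_iff_tendsto_slope_zero.1 (ht z (Metric.mem_ball_self hrpos))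
    refine h1.comp (tendsto_nhdsWithin_iff.2 ⟨?_, Eventually.of_forall fun n => ?_⟩)
    · have h2 : Tendsto (fun n : ℕ => r / ((n : ℝ) + 1)) atTop (𝓝 0) := by
        have := (tendsto_one_div_add_atTop_nhds_zero_nat (𝕜 := ℝ)).const_mul r
        simpa [div_eq_mul_inv] using this
      simpa [Function.comp_def] using (Complex.continuous_ofReal.tendsto 0).comp h2
    · have : r / ((n : ℝ) + 1) ≠ 0 := by positivity
      simpa only [mem_compl_iff, mem_singleton_iff, Complex.ofReal_eq_zero] using this
  have hint : Integrable (F z) μ := hbound.mono' (hmeas z hz) (hle.mono fun t ht => ht z hz)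
  have := (hasDerivAt_integral_of_dominated_loc_of_deriv_le (F := F)
    (F' := fun w t => deriv (fun w => F w t) w) (bound := fun t => bound t / (r / 2))
    (Metric.ball_mem_nhds z hrpos)
    (by filter_upwards [hU.mem_nhds hz] with w hw using hmeas w hw)
    hint hmeas' hderiv_le (hbound.div_const _) hderiv).2
  exact this.differentiableAt.differentiableWithinAt

/-! ### The Cauchy transform near and across the curve -/

lemma cauchyIntegrand_eq (γ : ℝ → ℂ) (g : ℂ → ℂ) (z : ℂ) :
    cauchyIntegrand γ g z = fun t => (γ t - z)⁻¹ * (g (γ t) * deriv γ t) := by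
  ext t
  simp only [cauchyIntegrand]
  ring

lemma norm_cauchyIntegrand_le {γ : ℝ → ℂ} {g : ℂ → ℂ} {z : ℂ} {ρ : ℝ} (hρ : 0 < ρ) {t : ℝ}
    (h : ρ ≤ ‖γ t - z‖) : ‖cauchyIntegrand γ g z t‖ ≤ ρ⁻¹ * ‖g (γ t) * deriv γ t‖ := by
  rw [cauchyIntegrand_eq, norm_mul, norm_inv]
  gcongr

lemma aestronglyMeasurable_cauchyIntegrand {γ : ℝ → ℂ} {g : ℂ → ℂ} (hγ : Continuous γ)
    (hφ : AEStronglyMeasurable (fun t => g (γ t) * deriv γ t)) (z : ℂ) :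
    AEStronglyMeasurable (cauchyIntegrand γ g z) := by
  rw [cauchyIntegrand_eq]
  exact (hγ.measurable.sub_const z).inv.aestronglyMeasurable.mul hφ

lemma integrableOn_cauchyIntegrand {γ : ℝ → ℂ} {g : ℂ → ℂ} (hγ : Continuous γ)
    (hφ : Integrable (fun t => g (γ t) * deriv γ t)) {S : Set ℝ} (hS : MeasurableSet S) {z : ℂ}
    {ρ : ℝ} (hρ : 0 < ρ) (h : ∀ t ∈ S, ρ ≤ ‖γ t - z‖) : IntegrableOn (cauchyIntegrand γ g z) S :=
  (hφ.norm.const_mul ρ⁻¹).integrableOn.mono'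
    (aestronglyMeasurable_cauchyIntegrand hγ hφ.1 z).restrict
    ((ae_restrict_mem hS).mono fun t ht => norm_cauchyIntegrand_le hρ (h t ht))

lemma half_le_norm_sub {x w z : ℂ} {ρ : ℝ} (h : ρ ≤ ‖x - z‖) (hw : w ∈ Metric.ball z (ρ / 2)) :
    ρ / 2 ≤ ‖x - w‖ := by
  rw [mem_ball_iff_norm] at hw
  have : ‖x - z‖ ≤ ‖x - w‖ + ‖w - z‖ := by simpa using norm_add_le (x - w) (w - z)
  linarith

lemma differentiableOn_setIntegral_cauchyIntegrand {γ : ℝ → ℂ} {g : ℂ → ℂ} (hγ : Continuous γ)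
    (hφ : Integrable (fun t => g (γ t) * deriv γ t)) {S : Set ℝ} (hS : MeasurableSet S) {z : ℂ}
    {ρ : ℝ} (hρ : 0 < ρ) (h : ∀ t ∈ S, ρ ≤ ‖γ t - z‖) :
    DifferentiableOn ℂ (fun w => ∫ t in S, cauchyIntegrand γ g w t) (Metric.ball z (ρ / 2)) := by
  refine differentiableOn_integral_of_dominated Metric.isOpen_ball
    (fun w _ => (aestronglyMeasurable_cauchyIntegrand hγ hφ.1 w).restrict) ?_
    (hφ.norm.const_mul (ρ / 2)⁻¹).integrableOn ?_
  · filter_upwards [ae_restrict_mem hS] with t ht w hw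
    have h1 := half_le_norm_sub (h t ht) hw
    have h2 : γ t - w ≠ 0 := norm_pos_iff.1 (by linarith)
    simp only [cauchyIntegrand]
    exact (((differentiableAt_const _).div ((differentiableAt_const _).sub differentiableAt_id)
      h2).mul (differentiableAt_const _)).differentiableWithinAt
  · filter_upwards [ae_restrict_mem hS] with t ht w hw
    exact norm_cauchyIntegrand_le (by positivity) (half_le_norm_sub (h t ht) hw)

theorem integrable_cauchyIntegrand {γ : ℝ → ℂ} {g : ℂ → ℂ} (hγ : Continuous γ)
    (hlim : Tendsto (fun τ => ‖γ τ‖) (atBot ⊔ atTop) atTop)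
    (hφ : Integrable (fun t => g (γ t) * deriv γ t)) {z : ℂ} (hz : z ∉ range γ) :
    Integrable (cauchyIntegrand γ g z) := by
  obtain ⟨ρ, hρ, h⟩ := exists_dist_le_of_notMem (isClosed_image_of_tendsto hγ hlim isClosed_univ)
    (z := z) (by rwa [image_univ])
  exact integrableOn_univ.1 (integrableOn_cauchyIntegrand hγ hφ MeasurableSet.univ hρ h)

theorem differentiableOn_cauchyTransform {γ : ℝ → ℂ} {g : ℂ → ℂ} (hγ : Continuous γ)
    (hlim : Tendsto (fun τ => ‖γ τ‖) (atBot ⊔ atTop) atTop)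
    (hφ : Integrable (fun t => g (γ t) * deriv γ t)) :
    DifferentiableOn ℂ (cauchyTransform γ g) (range γ)ᶜ := by
  intro z hz
  obtain ⟨ρ, hρ, h⟩ := exists_dist_le_of_notMem (isClosed_image_of_tendsto hγ hlim isClosed_univ)
    (z := z) (by rwa [image_univ])
  have := differentiableOn_setIntegral_cauchyIntegrand hγ hφ MeasurableSet.univ hρ h
  simp only [Measure.restrict_univ] at this
  exact ((this.const_mul (2 * Real.pi * Complex.I)⁻¹).differentiableAt
    (Metric.ball_mem_nhds z (by positivity))).differentiableWithinAt

lemma dslope_comm' {g : ℂ → ℂ} (x y : ℂ) : dslope g x y = dslope g y x := by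
  by_cases h : x = y
  · rw [h]
  · rw [dslope_of_ne _ (Ne.symm h), dslope_of_ne _ h, slope_comm]

lemma norm_dslope_le {g : ℂ → ℂ} {V : Set ℂ} (hV : IsOpen V) (hc : Convex ℝ V)
    (hg : DifferentiableOn ℂ g V) {M : ℝ} (hM : ∀ x ∈ V, ‖deriv g x‖ ≤ M) {x y : ℂ} (hx : x ∈ V)
    (hy : y ∈ V) : ‖dslope g x y‖ ≤ M := by
  by_cases h : y = x
  · rw [h, dslope_same]
    exact hM x hx
  · rw [dslope_of_ne _ h, slope_def_field, norm_div, div_le_iff₀ (norm_pos_iff.2 (sub_ne_zero.2 h))]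
    exact hc.norm_image_sub_le_of_norm_deriv_le
      (fun z hz => hg.differentiableAt (hV.mem_nhds hz)) hM hx hy

/-- By symmetry of `dslope` the integrand is holomorphic in `w`, also at `w = γ t`, and on a disc it
is dominated by the maximum of `‖g'‖` times `‖γ'‖`. -/
lemma differentiableOn_integral_dslope {γ : ℝ → ℂ} {g : ℂ → ℂ} {T : Set ℂ} (hT : IsOpen T)
    (hg : DifferentiableOn ℂ g T) (hγ : Continuous γ) {ζ : ℂ} {R : ℝ}
    (hR : Metric.closedBall ζ R ⊆ T) {a b : ℝ} (hγR : ∀ t ∈ Icc a b, γ t ∈ Metric.ball ζ R)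
    (hint : IntegrableOn (deriv γ) (Ioc a b)) :
    DifferentiableOn ℂ (fun w => ∫ t in Ioc a b, dslope g w (γ t) * deriv γ t)
        (Metric.ball ζ R) ∧
      ∀ w ∈ Metric.ball ζ R, IntegrableOn (fun t => dslope g w (γ t) * deriv γ t) (Ioc a b) := by
  have hbT : Metric.ball ζ R ⊆ T := Metric.ball_subset_closedBall.trans hR
  obtain ⟨M, hM⟩ := (isCompact_closedBall ζ R).exists_bound_of_continuousOn
    ((hg.deriv hT).continuousOn.mono hR)
  have hle : ∀ w ∈ Metric.ball ζ R, ∀ t ∈ Ioc a b,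
      ‖dslope g w (γ t) * deriv γ t‖ ≤ M * ‖deriv γ t‖ := fun w hw t ht => by
    rw [norm_mul]
    gcongr
    exact norm_dslope_le Metric.isOpen_ball (convex_ball ζ R) (hg.mono hbT)
      (fun x hx => hM x (Metric.ball_subset_closedBall hx)) hw (hγR t (Ioc_subset_Icc_self ht))
  have hmeas : ∀ w ∈ Metric.ball ζ R, AEStronglyMeasurable
      (fun t => dslope g w (γ t) * deriv γ t) (volume.restrict (Ioc a b)) := fun w hw => by
    have h1 : ContinuousOn (dslope g w) (Metric.ball ζ R) :=
      ((Complex.differentiableOn_dslope (Metric.isOpen_ball.mem_nhds hw)).2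
        (hg.mono hbT)).continuousOn
    have h2 : ContinuousOn (fun t => dslope g w (γ t)) (Ioc a b) :=
      h1.comp hγ.continuousOn fun t ht => hγR t (Ioc_subset_Icc_self ht)
    exact (h2.aestronglyMeasurable measurableSet_Ioc).mul hint.1
  refine ⟨differentiableOn_integral_of_dominated Metric.isOpen_ball hmeas ?_
    (hint.norm.const_mul M) ?_, fun w hw => (hint.norm.const_mul M).mono' (hmeas w hw) ?_⟩
  · filter_upwards [ae_restrict_mem measurableSet_Ioc] with t ht
    have h1 : DifferentiableOn ℂ (dslope g (γ t)) (Metric.ball ζ R) :=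
      (Complex.differentiableOn_dslope (Metric.isOpen_ball.mem_nhds
        (hγR t (Ioc_subset_Icc_self ht)))).2 (hg.mono hbT)
    simp only [fun w => dslope_comm' (g := g) w (γ t)]
    exact h1.mul_const _
  · filter_upwards [ae_restrict_mem measurableSet_Ioc] with t ht w hw using hle w hw t ht
  · filter_upwards [ae_restrict_mem measurableSet_Ioc] with t ht using hle w hw t ht

lemma exists_local_extension {γ : ℝ → ℂ} {g : ℂ → ℂ} {T : Set ℂ} (hT : IsOpen T)
    (hg : DifferentiableOn ℂ g T) (hγT : ∀ t, γ t ∈ T) (h : IsPiecewiseSmooth γ)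
    (hinj : Function.Injective γ) (hlim : Tendsto (fun τ => ‖γ τ‖) (atBot ⊔ atTop) atTop)
    (hint : ∀ a b, IntervalIntegrable (deriv γ) volume a b)
    (hφ : Integrable (fun t => g (γ t) * deriv γ t)) {χ : ℂ → ℤ}
    (hχ : ∀ w w', w ∉ range γ → w' ∉ range γ → HasRelativeWindingNumber γ w w' (χ w' - χ w))
    (t₀ : ℝ) :
    ∃ r > 0, ∃ F : ℂ → ℂ, DifferentiableOn ℂ F (Metric.ball (γ t₀) r) ∧
      ∀ w ∈ Metric.ball (γ t₀) r, w ∉ range γ → F w = cauchyTransform γ g w + χ w * g w := by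
  obtain ⟨R, hR, hRT⟩ := Metric.nhds_basis_closedBall.mem_iff.1 (hT.mem_nhds (hγT t₀))
  obtain ⟨η, hη, hηR⟩ := Metric.nhds_basis_closedBall.mem_iff.1
    (h.1.continuousAt.preimage_mem_nhds (Metric.ball_mem_nhds (γ t₀) hR))
  set a := t₀ - η
  set b := t₀ + η
  have hab : a ≤ b := by simp only [a, b]; linarith
  rw [Real.closedBall_eq_Icc] at hηR
  obtain ⟨ρ, hρ, hfar⟩ := exists_dist_le_compl_Ioo h.1 hinj hlim (a := a) (b := b) (t₀ := t₀)
    ⟨by simp only [a]; linarith, by simp only [b]; linarith⟩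
  obtain ⟨Λ, hΛ, hΛeq⟩ := exists_local_log h hlim hχ hfar (hint a b)
  have hfar' : ∀ t ∈ (Ioc a b)ᶜ, ρ ≤ ‖γ t - γ t₀‖ := fun t ht =>
    hfar t fun ht' => ht (Ioo_subset_Ioc_self ht')
  have hintO : IntegrableOn (deriv γ) (Ioc a b) := (hint a b).1
  obtain ⟨hD, hDint⟩ := differentiableOn_integral_dslope hT hg h.1 hRT (fun t ht => hηR ht) hintO
  have hO := differentiableOn_setIntegral_cauchyIntegrand h.1 hφ measurableSet_Ioc.compl hρ hfar'
  set r := min R (ρ / 3)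
  have hrR : Metric.ball (γ t₀) r ⊆ Metric.ball (γ t₀) R := Metric.ball_subset_ball (min_le_left _ _)
  have hrρ : Metric.ball (γ t₀) r ⊆ Metric.ball (γ t₀) (ρ / 3) :=
    Metric.ball_subset_ball (min_le_right _ _)
  -- The far part of the curve, the regular part of the near arc, and `g w` times its logarithmic
  -- integral with the jump removed. The `2πi χ w` inside `Λ w` contributes exactly `χ w * g w`.
  refine ⟨r, by positivity, fun w => (2 * Real.pi * Complex.I)⁻¹ *
    ((∫ t in (Ioc a b)ᶜ, cauchyIntegrand γ g w t) +
      (∫ t in Ioc a b, dslope g w (γ t) * deriv γ t) + g w * Λ w), ?_, ?_⟩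
  · refine DifferentiableOn.const_mul (((hO.mono (hrρ.trans
      (Metric.ball_subset_ball (by linarith)))).add (hD.mono hrR)).add
      ((hg.mono ?_).mul (hΛ.mono hrρ))) _
    exact hrR.trans (Metric.ball_subset_closedBall.trans hRT)
  · intro w hw hwγ
    have hpi := Complex.two_pi_I_ne_zero
    have hne : ∀ t, γ t - w ≠ 0 := fun t => sub_ne_zero.2 fun h => hwγ ⟨t, h⟩
    have hI := integrable_cauchyIntegrand h.1 hlim hφ hwγ
    have i1 : IntegrableOn (fun t => (γ t - w)⁻¹ * deriv γ t) (Ioc a b) :=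
      ((hint a b).continuousOn_mul ((h.1.sub continuous_const).inv₀ hne).continuousOn).1
    have h2 : ∫ t in Ioc a b, cauchyIntegrand γ g w t =
        (∫ t in Ioc a b, dslope g w (γ t) * deriv γ t) +
          g w * ∫ t in Ioc a b, (γ t - w)⁻¹ * deriv γ t := by
      rw [← integral_const_mul, ← integral_add (hDint w (hrR hw)) (i1.const_mul _)]
      refine integral_congr_ae (Eventually.of_forall fun t => ?_)
      have := hne t
      simp only [cauchyIntegrand]
      rw [dslope_of_ne _ (fun h => hwγ ⟨t, h⟩), slope_def_field]
      field_simp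
      ring
    simp only [cauchyTransform]
    rw [← integral_add_compl measurableSet_Ioc hI, h2, hΛeq w (hrρ hw) hwγ,
      intervalIntegral.integral_of_le hab]
    field_simp
    ring

/-! ### The range of the curve is a null set, and the glued function is entire -/

/-- Precomposed with the real part, `γ` is a differentiable map on a null subset of the plane, whose
image is null; the break points add a countable set. -/
lemma IsPiecewiseSmooth.volume_range {γ : ℝ → ℂ} (h : IsPiecewiseSmooth γ) :
    volume (range γ) = 0 := by
  obtain ⟨E, hE, hd⟩ := h.exists_countable
  set s : Set ℂ := {w | w.im = 0 ∧ w.re ∉ E} with hs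
  have h1 : volume s = 0 := by
    have : volume ((LinearMap.ker Complex.imLm : Submodule ℝ ℂ) : Set ℂ) = 0 := by
      apply Measure.addHaar_submodule
      intro htop
      have : Complex.I ∈ LinearMap.ker Complex.imLm := htop ▸ Submodule.mem_top
      simp at this
    exact measure_mono_null (fun w hw => by simpa using hw.1) this
  have h2 : DifferentiableOn ℝ (fun w : ℂ => γ w.re) s := fun w hw =>
    ((hd w.re hw.2).comp w Complex.reCLM.differentiableAt).differentiableWithinAt
  have h3 := addHaar_image_eq_zero_of_differentiableOn_of_addHaar_eq_zero volume h2 h1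
  have h4 : volume (γ '' E) = 0 := (hE.image γ).measure_zero _
  refine measure_mono_null ?_ (measure_union_null h3 h4)
  rintro _ ⟨t, rfl⟩
  by_cases ht : t ∈ E
  · exact Or.inr ⟨t, ht, rfl⟩
  · exact Or.inl ⟨(t : ℂ), ⟨by simp, by simpa using ht⟩, by simp⟩

theorem exists_entire_extension {S : Set ℂ} (hS : IsClosed S) (hS0 : volume S = 0) {f : ℂ → ℂ}
    (hf : DifferentiableOn ℂ f Sᶜ)
    (hloc : ∀ ζ ∈ S, ∃ r > 0, ∃ F : ℂ → ℂ, DifferentiableOn ℂ F (Metric.ball ζ r) ∧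
      ∀ w ∈ Metric.ball ζ r, w ∉ S → F w = f w) :
    ∃ f' : ℂ → ℂ, Differentiable ℂ f' ∧ ∀ w ∉ S, f' w = f w := by
  classical
  choose! r hr F hF hFf using hloc
  have hdense : Dense Sᶜ := interior_eq_empty_iff_dense_compl.1 (Measure.interior_eq_empty_of_null hS0)
  refine ⟨fun z => if z ∈ S then F z z else f z, fun z => ?_, fun w hw => by simp [hw]⟩
  by_cases hz : z ∈ S
  · have hev : (fun z => if z ∈ S then F z z else f z) =ᶠ[𝓝 z] F z := by
      filter_upwards [Metric.ball_mem_nhds z (hr z hz)] with w hw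
      by_cases hwS : w ∈ S
      · rw [if_pos hwS]
        -- At a point of `S` in both discs, both local extensions are limits of `f` through the
        -- dense complement, so they agree.
        have : (𝓝[Sᶜ] w).NeBot := mem_closure_iff_nhdsWithin_neBot.1 (hdense w)
        have l1 : Tendsto (F w) (𝓝[Sᶜ] w) (𝓝 (F w w)) :=
          (((hF w hwS).differentiableAt (Metric.ball_mem_nhds w (hr w hwS))).continuousAt
            ).tendsto.mono_left nhdsWithin_le_nhds
        have l2 : Tendsto (F z) (𝓝[Sᶜ] w) (𝓝 (F z w)) :=
          (((hF z hz).differentiableAt (Metric.isOpen_ball.mem_nhds hw)).continuousAt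
            ).tendsto.mono_left nhdsWithin_le_nhds
        refine tendsto_nhds_unique l1 (l2.congr' ?_)
        filter_upwards [self_mem_nhdsWithin,
          nhdsWithin_le_nhds (Metric.ball_mem_nhds w (hr w hwS)),
          nhdsWithin_le_nhds (Metric.isOpen_ball.mem_nhds hw)] with x hx h1 h2
        rw [hFf w hwS x h1 hx, hFf z hz x h2 hx]
      · rw [if_neg hwS, hFf z hz w hw hwS]
    exact ((hF z hz).differentiableAt (Metric.ball_mem_nhds z (hr z hz))).congr_of_eventuallyEq hev
  · refine (hf.differentiableAt (hS.isOpen_compl.mem_nhds hz)).congr_of_eventuallyEq ?_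
    filter_upwards [hS.isOpen_compl.mem_nhds hz] with w hw
    exact if_neg hw

/-! ### Averages over discs -/

lemma setLIntegral_ball_eq_polar (F : ℂ → ENNReal) (z : ℂ) (ρ : ℝ) :
    ∫⁻ w in Metric.ball z ρ, F w = ∫⁻ p in Ioo 0 ρ ×ˢ Ioo (-Real.pi) Real.pi,
      ENNReal.ofReal p.1 * F (circleMap z p.1 p.2) := by
  have hpol : ∀ p : ℝ × ℝ, z + Complex.polarCoord.symm p = circleMap z p.1 p.2 := fun p => by
    rw [Complex.polarCoord_symm_apply, circleMap, Complex.exp_mul_I]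
    push_cast; rfl
  rw [← lintegral_indicator measurableSet_ball, ← lintegral_add_left_eq_self _ z,
    ← Complex.lintegral_comp_polarCoord_symm]
  have hset : Ioo 0 ρ ×ˢ Ioo (-Real.pi) Real.pi = {p : ℝ × ℝ | p.1 < ρ} ∩ polarCoord.target := by
    ext p
    simp only [polarCoord_target, mem_prod, mem_Ioo, mem_inter_iff, mem_ofPred_eq, mem_Ioi]
    tauto
  have hms : MeasurableSet {p : ℝ × ℝ | p.1 < ρ} := measurableSet_lt measurable_fst measurable_const
  rw [hset, ← Measure.restrict_restrict hms, ← lintegral_indicator hms]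
  refine setLIntegral_congr_fun polarCoord.open_target.measurableSet fun p hp => ?_
  have hp1 : 0 < p.1 := hp.1
  simp only [hpol, smul_eq_mul]
  by_cases h : p.1 < ρ
  · rw [indicator_of_mem (by simpa [circleMap, abs_of_pos hp1] using h),
      indicator_of_mem (show p ∈ {p : ℝ × ℝ | p.1 < ρ} from h)]
  · rw [indicator_of_notMem (by simpa [circleMap, abs_of_pos hp1] using h),
      indicator_of_notMem (show p ∉ {p : ℝ × ℝ | p.1 < ρ} from h), mul_zero]

lemma volume_ball_eq_polar (z : ℂ) (ρ : ℝ) : volume (Metric.ball z ρ) =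
    ∫⁻ p : ℝ × ℝ in Ioo 0 ρ ×ˢ Ioo (-Real.pi) Real.pi, ENNReal.ofReal p.1 := by
  simpa using setLIntegral_ball_eq_polar (fun _ => 1) z ρ

/-- The Jacobian of polar coordinates cancels the kernel. -/
lemma setLIntegral_ball_inv_enorm_self (ζ : ℂ) {ρ : ℝ} (hρ : 0 ≤ ρ) :
    ∫⁻ w in Metric.ball ζ ρ, ‖ζ - w‖ₑ⁻¹ = ENNReal.ofReal (2 * Real.pi * ρ) := by
  rw [setLIntegral_ball_eq_polar]
  have : ∀ p ∈ Ioo 0 ρ ×ˢ Ioo (-Real.pi) Real.pi,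
      ENNReal.ofReal p.1 * ‖ζ - circleMap ζ p.1 p.2‖ₑ⁻¹ = 1 := by
    intro p hp
    have hp1 : 0 < p.1 := hp.1.1
    have : ‖ζ - circleMap ζ p.1 p.2‖ₑ = ENNReal.ofReal p.1 := by
      rw [← ofReal_norm, norm_sub_rev]
      simp [circleMap, abs_of_pos hp1]
    rw [this, ENNReal.mul_inv_cancel (by simpa using hp1) ENNReal.ofReal_ne_top]
  rw [setLIntegral_congr_fun (measurableSet_Ioo.prod measurableSet_Ioo) this]
  simp only [lintegral_const, one_mul, Measure.restrict_apply_univ, Measure.volume_eq_prod,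
    Measure.prod_prod, Real.volume_Ioo]
  rw [← ENNReal.ofReal_mul (by linarith)]
  congr 1
  ring

lemma setLIntegral_ball_inv_enorm_le_of_dist {z ζ : ℂ} {ρ d : ℝ} {s : Set ℂ}
    (hs : MeasurableSet s) (hsb : s ⊆ Metric.ball z ρ) (hd : 0 < d) (h : ∀ w ∈ s, d ≤ ‖ζ - w‖) :
    ∫⁻ w in s, ‖ζ - w‖ₑ⁻¹ ≤ volume (Metric.ball z ρ) * ENNReal.ofReal d⁻¹ := by
  calc ∫⁻ w in s, ‖ζ - w‖ₑ⁻¹ ≤ ∫⁻ w in s, ENNReal.ofReal d⁻¹ := by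
        refine setLIntegral_mono' hs fun w hw => ?_
        rw [ENNReal.ofReal_inv_of_pos hd, ENNReal.inv_le_inv, ← ofReal_norm]
        exact ENNReal.ofReal_le_ofReal (h w hw)
    _ ≤ _ := by
        rw [setLIntegral_const, mul_comm]
        gcongr

lemma volume_ball_eq_ofReal (z : ℂ) {ρ : ℝ} (hρ : 0 ≤ ρ) :
    volume (Metric.ball z ρ) = ENNReal.ofReal (Real.pi * ρ ^ 2) := by
  rw [Complex.volume_ball, mul_comm Real.pi, ENNReal.ofReal_mul (by positivity),
    ENNReal.ofReal_pow hρ]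
  congr 1
  exact (ENNReal.ofReal_coe_nnreal (p := NNReal.pi)).symm

/-- Within `ρ` of `ζ` the kernel contributes at most `2πρ`, which is `2/ρ` times the area; elsewhere
it is at most `1/ρ`. -/
lemma setLIntegral_ball_inv_enorm_le (z ζ : ℂ) {ρ : ℝ} (hρ : 0 < ρ) :
    ∫⁻ w in Metric.ball z ρ, ‖ζ - w‖ₑ⁻¹ ≤
      volume (Metric.ball z ρ) * ENNReal.ofReal (3 / ρ) := by
  rw [← lintegral_inter_add_sdiff _ _ (measurableSet_ball (x := ζ) (ε := ρ))]
  have h1 : ∫⁻ w in Metric.ball z ρ ∩ Metric.ball ζ ρ, ‖ζ - w‖ₑ⁻¹ ≤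
      volume (Metric.ball z ρ) * ENNReal.ofReal (2 / ρ) := by
    refine (lintegral_mono_set inter_subset_right).trans ?_
    rw [setLIntegral_ball_inv_enorm_self ζ hρ.le, volume_ball_eq_ofReal z hρ.le,
      ← ENNReal.ofReal_mul (by positivity)]
    refine ENNReal.ofReal_le_ofReal (le_of_eq ?_)
    field_simp
  have h2 : ∫⁻ w in Metric.ball z ρ \ Metric.ball ζ ρ, ‖ζ - w‖ₑ⁻¹ ≤
      volume (Metric.ball z ρ) * ENNReal.ofReal ρ⁻¹ := by
    refine setLIntegral_ball_inv_enorm_le_of_dist (measurableSet_ball.diff measurableSet_ball)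
      sdiff_subset hρ fun w hw => ?_
    have := hw.2
    rw [mem_ball_iff_norm, not_lt, norm_sub_rev] at this
    exact this
  refine (add_le_add h1 h2).trans ?_
  rw [← mul_add, ← ENNReal.ofReal_add (by positivity) (by positivity)]
  refine le_of_eq ?_
  congr 2
  field_simp
  norm_num

lemma enorm_le_lintegral_circleMap {f : ℂ → ℂ} (hf : Differentiable ℂ f) (z : ℂ) (R : ℝ) :
    ENNReal.ofReal (2 * Real.pi) * ‖f z‖ₑ ≤
      ∫⁻ θ in Ioo (-Real.pi) Real.pi, ‖f (circleMap z R θ)‖ₑ := by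
  have h1 : Real.circleAverage f z R = f z := (hf.diffContOnCl).circleAverage
  have h2 : ∫ θ in (0 : ℝ)..2 * Real.pi, f (circleMap z R θ) =
      ∫ θ in Ioo (-Real.pi) Real.pi, f (circleMap z R θ) := by
    have hper : Function.Periodic (fun θ => f (circleMap z R θ)) (2 * Real.pi) := fun θ => by
      simp only [periodic_circleMap z R θ]
    have := hper.intervalIntegral_add_eq 0 (-Real.pi)
    rw [zero_add, show -Real.pi + 2 * Real.pi = Real.pi by ring] at this
    rw [this, intervalIntegral.integral_of_le (by linarith [Real.pi_pos]), integral_Ioc_eq_integral_Ioo]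
  rw [Real.circleAverage_def, h2] at h1
  have h3 : ((2 * Real.pi : ℝ) : ℂ) * f z = ∫ θ in Ioo (-Real.pi) Real.pi, f (circleMap z R θ) := by
    rw [← h1, Complex.real_smul]
    push_cast
    have := Real.pi_ne_zero
    field_simp
  have h4 : ENNReal.ofReal (2 * Real.pi) * ‖f z‖ₑ = ‖((2 * Real.pi : ℝ) : ℂ) * f z‖ₑ := by
    rw [enorm_mul, ← ofReal_norm ((2 * Real.pi : ℝ) : ℂ), Complex.norm_real,
      Real.norm_of_nonneg (by positivity)]
  rw [h4, h3]
  exact enorm_integral_le_lintegral_enorm _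

/-- The sub-mean value property over discs. -/
theorem volume_ball_mul_enorm_le {f : ℂ → ℂ} (hf : Differentiable ℂ f) (z : ℂ) (ρ : ℝ) :
    volume (Metric.ball z ρ) * ‖f z‖ₑ ≤ ∫⁻ w in Metric.ball z ρ, ‖f w‖ₑ := by
  have hc : Continuous fun p : ℝ × ℝ => f (circleMap z p.1 p.2) := by
    refine hf.continuous.comp ?_
    unfold circleMap
    fun_prop
  have hm1 : Measurable fun p : ℝ × ℝ => ENNReal.ofReal p.1 :=
    ENNReal.measurable_ofReal.comp measurable_fst
  have hm2 : Measurable fun p : ℝ × ℝ => ENNReal.ofReal p.1 * ‖f (circleMap z p.1 p.2)‖ₑ :=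
    hm1.mul hc.enorm.measurable
  rw [setLIntegral_ball_eq_polar, volume_ball_eq_polar, Measure.volume_eq_prod,
    ← Measure.prod_restrict, lintegral_prod _ hm1.aemeasurable, lintegral_prod _ hm2.aemeasurable,
    ← lintegral_mul_const' _ _ enorm_ne_top]
  refine lintegral_mono fun r => ?_
  have e1 : ∫⁻ _ in Ioo (-Real.pi) Real.pi, ENNReal.ofReal r =
      ENNReal.ofReal r * ENNReal.ofReal (2 * Real.pi) := by
    rw [setLIntegral_const, Real.volume_Ioo, show Real.pi - -Real.pi = 2 * Real.pi by ring]
  have e2 : ∫⁻ θ in Ioo (-Real.pi) Real.pi, ENNReal.ofReal r * ‖f (circleMap z r θ)‖ₑ =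
      ENNReal.ofReal r * ∫⁻ θ in Ioo (-Real.pi) Real.pi, ‖f (circleMap z r θ)‖ₑ :=
    lintegral_const_mul' _ _ ENNReal.ofReal_ne_top
  calc (∫⁻ _ in Ioo (-Real.pi) Real.pi, ENNReal.ofReal r) * ‖f z‖ₑ
      = ENNReal.ofReal r * (ENNReal.ofReal (2 * Real.pi) * ‖f z‖ₑ) := by rw [e1, mul_assoc]
    _ ≤ ENNReal.ofReal r * ∫⁻ θ in Ioo (-Real.pi) Real.pi, ‖f (circleMap z r θ)‖ₑ := by
        gcongr
        exact enorm_le_lintegral_circleMap hf z r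
    _ = _ := e2.symm

theorem setLIntegral_cauchyTransform_le {γ : ℝ → ℂ} {g : ℂ → ℂ} (hγ : Continuous γ)
    (hφ : AEStronglyMeasurable (fun t => g (γ t) * deriv γ t)) (B : Set ℂ) :
    ∫⁻ w in B, ‖cauchyTransform γ g w‖ₑ ≤ ENNReal.ofReal (2 * Real.pi)⁻¹ *
      ∫⁻ t, ‖g (γ t) * deriv γ t‖ₑ * ∫⁻ w in B, ‖γ t - w‖ₑ⁻¹ := by
  have hpt : ∀ w, ‖cauchyTransform γ g w‖ₑ ≤ ENNReal.ofReal (2 * Real.pi)⁻¹ *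
      ∫⁻ t, ‖g (γ t) * deriv γ t‖ₑ * ‖γ t - w‖ₑ⁻¹ := by
    intro w
    rw [cauchyTransform, enorm_mul]
    have : ‖(2 * Real.pi * Complex.I : ℂ)⁻¹‖ₑ = ENNReal.ofReal (2 * Real.pi)⁻¹ := by
      rw [← ofReal_norm]
      simp [abs_of_pos Real.pi_pos]
    rw [this]
    gcongr
    refine (enorm_integral_le_lintegral_enorm _).trans (lintegral_mono fun t => ?_)
    rw [cauchyIntegrand_eq, enorm_mul, mul_comm]
    gcongr
    -- At `γ t = w` the complex inverse is `0` and the extended one is `⊤`, so the bound holds on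
    -- the curve too.
    by_cases h : γ t - w = 0
    · simp [h]
    · rw [enorm_inv h]
  have hm : AEMeasurable (Function.uncurry fun (w : ℂ) (t : ℝ) =>
      ‖g (γ t) * deriv γ t‖ₑ * ‖γ t - w‖ₑ⁻¹) ((volume.restrict B).prod volume) := by
    refine AEMeasurable.mul ?_ ?_
    · exact hφ.enorm.comp_snd
    · have : Continuous fun p : ℂ × ℝ => γ p.2 - p.1 := by fun_prop
      exact this.measurable.enorm.inv.aemeasurable
  calc ∫⁻ w in B, ‖cauchyTransform γ g w‖ₑ
      ≤ ∫⁻ w in B, ENNReal.ofReal (2 * Real.pi)⁻¹ *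
        ∫⁻ t, ‖g (γ t) * deriv γ t‖ₑ * ‖γ t - w‖ₑ⁻¹ := lintegral_mono hpt
    _ = ENNReal.ofReal (2 * Real.pi)⁻¹ * ∫⁻ w in B, ∫⁻ t,
        ‖g (γ t) * deriv γ t‖ₑ * ‖γ t - w‖ₑ⁻¹ := by
        rw [lintegral_const_mul' _ _ ENNReal.ofReal_ne_top]
    _ = _ := by
        rw [lintegral_lintegral_swap hm]
        congr 1
        refine lintegral_congr fun t => ?_
        rw [lintegral_const_mul' _ _ enorm_ne_top]

/-! ### The bound for the Cauchy transform -/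

lemma one_le_plusNorm {E : Type*} [Norm E] (z : E) : 1 ≤ plusNorm z := le_max_right _ _

lemma plusNorm_pos {E : Type*} [Norm E] (z : E) : 0 < plusNorm z :=
  one_pos.trans_le (one_le_plusNorm z)

lemma sq_le_plusNorm_sq (t : ℝ) : t ^ 2 ≤ plusNorm t ^ 2 := by
  rw [← sq_abs t]
  exact pow_le_pow_left₀ (abs_nonneg t) (le_max_left _ _) 2

lemma continuous_plusNorm : Continuous (plusNorm : ℝ → ℝ) := continuous_norm.max continuous_const

lemma integrable_inv_sq_add_sq {R : ℝ} (hR : 0 < R) : Integrable fun t : ℝ => (t ^ 2 + R ^ 2)⁻¹ := by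
  have : (fun t : ℝ => (t ^ 2 + R ^ 2)⁻¹) = fun t => (R ^ 2)⁻¹ * (1 + (t / R) ^ 2)⁻¹ := by
    ext t
    rw [← mul_inv]
    congr 1
    field_simp
    ring
  rw [this]
  exact (integrable_inv_one_add_sq.comp_div hR.ne').const_mul _

lemma integral_univ_inv_sq_add_sq {R : ℝ} (hR : 0 < R) :
    ∫ t : ℝ, (t ^ 2 + R ^ 2)⁻¹ = Real.pi / R := by
  have : (fun t : ℝ => (t ^ 2 + R ^ 2)⁻¹) = fun t => (R ^ 2)⁻¹ * (1 + (t / R) ^ 2)⁻¹ := by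
    ext t
    rw [← mul_inv]
    congr 1
    field_simp
    ring
  rw [this, integral_const_mul, Measure.integral_comp_div (fun t : ℝ => (1 + t ^ 2)⁻¹) R,
    integral_univ_inv_one_add_sq, abs_of_pos hR, smul_eq_mul]
  field_simp

/-- An integrable majorant for the Cauchy integrals at a point `z` with `plusNorm z = Z`. -/
def cauchyMajorant (C₁ C₂ C₃ C₄ Z t : ℝ) : ℝ :=
  C₂ * C₃ * (4 / Z * (2 * (t ^ 2 + 1 ^ 2)⁻¹) +
    12 * C₄ * (2 * (t ^ 2 + (Z / (2 * C₁)) ^ 2)⁻¹))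

lemma cauchyMajorant_nonneg {C₁ C₂ C₃ C₄ Z : ℝ} (h₂ : 1 ≤ C₂) (h₃ : 1 ≤ C₃)
    (h₄ : 1 ≤ C₄) (hZ : 1 ≤ Z) (t : ℝ) : 0 ≤ cauchyMajorant C₁ C₂ C₃ C₄ Z t := by
  unfold cauchyMajorant
  positivity

lemma integrable_cauchyMajorant {C₁ C₂ C₃ C₄ Z : ℝ} (h₁ : 1 ≤ C₁) (hZ : 1 ≤ Z) :
    Integrable (cauchyMajorant C₁ C₂ C₃ C₄ Z) :=
  ((((integrable_inv_sq_add_sq one_pos).const_mul 2).const_mul (4 / Z)).add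
    (((integrable_inv_sq_add_sq (R := Z / (2 * C₁)) (by positivity)).const_mul 2).const_mul
      (12 * C₄))).const_mul (C₂ * C₃)

lemma integral_cauchyMajorant_le {C₁ C₂ C₃ C₄ Z : ℝ} (h₁ : 1 ≤ C₁) (h₂ : 1 ≤ C₂) (h₃ : 1 ≤ C₃)
    (h₄ : 1 ≤ C₄) (hZ : 1 ≤ Z) :
    (2 * Real.pi)⁻¹ * ∫ t, cauchyMajorant C₁ C₂ C₃ C₄ Z t ≤ 28 * (C₁ * C₂ * C₃ * C₄) / Z := by
  have hR : 0 < Z / (2 * C₁) := by positivity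
  have i1 := ((integrable_inv_sq_add_sq one_pos).const_mul 2).const_mul (4 / Z)
  have i2 := ((integrable_inv_sq_add_sq hR).const_mul 2).const_mul (12 * C₄)
  have : ∫ t, cauchyMajorant C₁ C₂ C₃ C₄ Z t =
      C₂ * C₃ * (4 / Z * (2 * (Real.pi / 1)) + 12 * C₄ * (2 * (Real.pi / (Z / (2 * C₁))))) := by
    simp only [cauchyMajorant]
    rw [integral_const_mul, integral_add i1 i2, integral_const_mul, integral_const_mul,
      integral_const_mul, integral_const_mul, integral_univ_inv_sq_add_sq hR,
      integral_univ_inv_sq_add_sq one_pos]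
  have e : (2 * Real.pi)⁻¹ * ∫ t, cauchyMajorant C₁ C₂ C₃ C₄ Z t =
      C₂ * C₃ * (4 + 24 * (C₁ * C₄)) / Z := by
    rw [this]
    have := Real.pi_ne_zero
    field_simp
    ring
  rw [e]
  have hp : 1 ≤ C₁ * C₄ := one_le_mul_of_one_le_of_one_le h₁ h₄
  refine div_le_div_of_nonneg_right ?_ (by positivity)
  have : 0 ≤ C₂ * C₃ := by positivity
  nlinarith

/-- Here `A` is a bound for the kernel at parameter `t`, either pointwise or averaged over a disc,
so one majorant serves both cases. For `R ≤ |t|₊` one has `|t|₊⁻² ≤ 2/(t²+R²)`, which makes the tail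
beyond `R` computable. -/
lemma mul_le_cauchyMajorant {C₁ C₂ C₃ C₄ Z δ₂ A N t : ℝ} (h₁ : 1 ≤ C₁) (h₂ : 1 ≤ C₂) (h₃ : 1 ≤ C₃)
    (h₄ : 1 ≤ C₄) (hZ : 1 ≤ Z) (hδ₂ : 0 ≤ δ₂) (hA : 0 ≤ A)
    (hN : N ≤ C₂ * C₃ * plusNorm t ^ (-(2 + δ₂)))
    (hnear : plusNorm t ≤ Z / (2 * C₁) → A ≤ 4 / Z)
    (hfar : Z / (2 * C₁) < plusNorm t → A ≤ 12 * C₄ * plusNorm t ^ δ₂) :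
    N * A ≤ cauchyMajorant C₁ C₂ C₃ C₄ Z t := by
  have hp1 := one_le_plusNorm t
  have hp := plusNorm_pos t
  have hpow : plusNorm t ^ (-(2 + δ₂)) * plusNorm t ^ δ₂ = (plusNorm t ^ 2)⁻¹ := by
    rw [← Real.rpow_add hp, show -(2 + δ₂) + δ₂ = -(2 : ℕ) by push_cast; ring,
      Real.rpow_neg hp.le, Real.rpow_natCast]
  have hpow1 : plusNorm t ^ (-(2 + δ₂)) ≤ (plusNorm t ^ 2)⁻¹ := by
    rw [← hpow]
    exact le_mul_of_one_le_right (by positivity) (Real.one_le_rpow hp1 hδ₂)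
  have hbase : ∀ R : ℝ, 0 < R → R ≤ plusNorm t → (plusNorm t ^ 2)⁻¹ ≤ 2 * (t ^ 2 + R ^ 2)⁻¹ := by
    intro R hR hRp
    have h5 : R ^ 2 ≤ plusNorm t ^ 2 := pow_le_pow_left₀ hR.le hRp 2
    have h6 := sq_le_plusNorm_sq t
    rw [← div_eq_mul_inv, inv_eq_one_div, div_le_div_iff₀ (by positivity) (by positivity)]
    linarith
  unfold cauchyMajorant
  rcases le_or_gt (plusNorm t) (Z / (2 * C₁)) with h | h
  · calc N * A ≤ (C₂ * C₃ * plusNorm t ^ (-(2 + δ₂))) * (4 / Z) := by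
          gcongr
          exact hnear h
      _ ≤ (C₂ * C₃ * (2 * (t ^ 2 + 1 ^ 2)⁻¹)) * (4 / Z) := by
          gcongr
          exact hpow1.trans (hbase 1 one_pos hp1)
      _ = C₂ * C₃ * (4 / Z * (2 * (t ^ 2 + 1 ^ 2)⁻¹)) := by ring
      _ ≤ _ := by
          gcongr
          exact le_add_of_nonneg_right (by positivity)
  · calc N * A ≤ (C₂ * C₃ * plusNorm t ^ (-(2 + δ₂))) * (12 * C₄ * plusNorm t ^ δ₂) := by
          gcongr
          exact hfar h
      _ = C₂ * C₃ * (12 * C₄ * (plusNorm t ^ (-(2 + δ₂)) * plusNorm t ^ δ₂)) := by ring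
      _ ≤ C₂ * C₃ * (12 * C₄ * (2 * (t ^ 2 + (Z / (2 * C₁)) ^ 2)⁻¹)) := by
          rw [hpow]
          gcongr
          exact hbase _ (by positivity) h.le
      _ ≤ _ := by
          gcongr
          exact le_add_of_nonneg_left (by positivity)

lemma norm_density_le {γ : ℝ → ℂ} {g : ℂ → ℂ} {C₂ C₃ δ₁ δ₂ : ℝ} (h₂ : 1 ≤ C₂)
    (hγ' : ∀ τ, DifferentiableAt ℝ γ τ → ‖deriv γ τ‖ ≤ C₂ * plusNorm τ ^ δ₁)
    (hg : ∀ τ, ‖g (γ τ)‖ ≤ C₃ * plusNorm τ ^ (-(2 + δ₁ + δ₂))) (t : ℝ) :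
    ‖g (γ t) * deriv γ t‖ ≤ C₂ * C₃ * plusNorm t ^ (-(2 + δ₂)) := by
  -- Where `γ` is not differentiable, `deriv γ t` is `0` by default.
  have hd : ‖deriv γ t‖ ≤ C₂ * plusNorm t ^ δ₁ := by
    by_cases h : DifferentiableAt ℝ γ t
    · exact hγ' t h
    · rw [deriv_zero_of_not_differentiableAt h, norm_zero]
      have := plusNorm_pos t
      positivity
  calc ‖g (γ t) * deriv γ t‖ ≤ (C₃ * plusNorm t ^ (-(2 + δ₁ + δ₂))) * (C₂ * plusNorm t ^ δ₁) := by
        rw [norm_mul]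
        exact mul_le_mul (hg t) hd (norm_nonneg _) ((norm_nonneg _).trans (hg t))
    _ = C₂ * C₃ * (plusNorm t ^ (-(2 + δ₁ + δ₂)) * plusNorm t ^ δ₁) := by ring
    _ = _ := by
        rw [← Real.rpow_add (plusNorm_pos t)]
        congr 2
        ring

lemma integrable_density {γ : ℝ → ℂ} {g : ℂ → ℂ} {C₂ C₃ δ₂ : ℝ} (h₂ : 1 ≤ C₂) (h₃ : 1 ≤ C₃)
    (hδ₂ : 0 ≤ δ₂) (hm : AEStronglyMeasurable (fun t => g (γ t) * deriv γ t))
    (hN : ∀ t, ‖g (γ t) * deriv γ t‖ ≤ C₂ * C₃ * plusNorm t ^ (-(2 + δ₂))) :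
    Integrable (fun t => g (γ t) * deriv γ t) := by
  refine (integrable_cauchyMajorant (C₁ := 1) (C₂ := C₂) (C₃ := C₃) (C₄ := 1) (Z := 1) le_rfl
    le_rfl).mono' hm (Eventually.of_forall fun t => ?_)
  have hp := Real.one_le_rpow (one_le_plusNorm t) hδ₂
  have := mul_le_cauchyMajorant (A := 1) (C₁ := 1) (C₄ := 1) (Z := 1) le_rfl h₂ h₃ le_rfl le_rfl
    hδ₂ zero_le_one (hN t) (fun _ => by norm_num) (fun _ => by linarith)
  simpa using this

/-- For parameters that are small compared to `z`, the curve is far from `z`. -/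
lemma half_le_of_plusNorm_le {γ : ℝ → ℂ} {C₁ : ℝ} (h₁ : 1 ≤ C₁)
    (hγ : ∀ τ, ‖γ τ‖ ≤ C₁ * plusNorm τ) {z : ℂ} {t : ℝ}
    (ht : plusNorm t ≤ plusNorm z / (2 * C₁)) : 2 ≤ plusNorm z ∧ plusNorm z / 2 ≤ ‖γ t - z‖ := by
  have hp := one_le_plusNorm t
  rw [le_div_iff₀ (by positivity)] at ht
  have h2 : 2 ≤ plusNorm z := by nlinarith
  have hz : plusNorm z = ‖z‖ := by
    rcases max_choice ‖z‖ 1 with h | h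
    · exact h
    · have : plusNorm z = 1 := h
      linarith
  refine ⟨h2, ?_⟩
  have h3 := norm_sub_norm_le z (γ t)
  rw [norm_sub_rev] at h3
  have := hγ t
  linarith

lemma norm_cauchyTransform_le_of_kernel {γ : ℝ → ℂ} {g : ℂ → ℂ} {z : ℂ} {B : ℝ → ℝ}
    (hB : Integrable B) (h : ∀ t, ‖cauchyIntegrand γ g z t‖ ≤ B t) :
    ‖cauchyTransform γ g z‖ ≤ (2 * Real.pi)⁻¹ * ∫ t, B t := by
  have e : ‖(2 * Real.pi * Complex.I : ℂ)⁻¹‖ = (2 * Real.pi)⁻¹ := by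
    simp [abs_of_pos Real.pi_pos]
  rw [cauchyTransform, norm_mul, e]
  gcongr
  exact norm_integral_le_of_norm_le hB (Eventually.of_forall h)

/-- An entire function that differs from the Cauchy transform by a bounded function on a disc is
bounded at its centre by the averages of the Cauchy kernel. -/
lemma norm_le_of_average_kernel {γ : ℝ → ℂ} {g f : ℂ → ℂ} (hγ : Continuous γ)
    (hφ : AEStronglyMeasurable (fun t => g (γ t) * deriv γ t)) (hf : Differentiable ℂ f) {z : ℂ}
    {ρ G : ℝ} (hρ : 0 < ρ) (hG : 0 ≤ G)
    (hfG : ∀ᵐ w, w ∈ Metric.ball z ρ → ‖f w‖ ≤ ‖cauchyTransform γ g w‖ + G) {B : ℝ → ℝ}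
    (hB : Integrable B) (hB0 : ∀ t, 0 ≤ B t)
    (h : ∀ t, ∃ A, ∫⁻ w in Metric.ball z ρ, ‖γ t - w‖ₑ⁻¹ ≤
      volume (Metric.ball z ρ) * ENNReal.ofReal A ∧ ‖g (γ t) * deriv γ t‖ * A ≤ B t) :
    ‖f z‖ ≤ (2 * Real.pi)⁻¹ * (∫ t, B t) + G := by
  set V := volume (Metric.ball z ρ) with hV
  have hV0 : V ≠ 0 := (Metric.measure_ball_pos volume z hρ).ne'
  have hVt : V ≠ ⊤ := measure_ball_lt_top.ne
  have hIB : 0 ≤ ∫ t, B t := integral_nonneg hB0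
  have h1 : ∫⁻ w in Metric.ball z ρ, ‖f w‖ₑ ≤
      (∫⁻ w in Metric.ball z ρ, ‖cauchyTransform γ g w‖ₑ) + V * ENNReal.ofReal G := by
    calc ∫⁻ w in Metric.ball z ρ, ‖f w‖ₑ
        ≤ ∫⁻ w in Metric.ball z ρ, (‖cauchyTransform γ g w‖ₑ + ENNReal.ofReal G) := by
          refine lintegral_mono_ae ?_
          rw [ae_restrict_iff' measurableSet_ball]
          filter_upwards [hfG] with w hw hwb
          rw [← ofReal_norm, ← ofReal_norm, ← ENNReal.ofReal_add (norm_nonneg _) hG]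
          exact ENNReal.ofReal_le_ofReal (hw hwb)
      _ = _ := by
          rw [lintegral_add_right _ measurable_const, setLIntegral_const, mul_comm V]
  have h2 : ∫⁻ t, ‖g (γ t) * deriv γ t‖ₑ * ∫⁻ w in Metric.ball z ρ, ‖γ t - w‖ₑ⁻¹ ≤
      V * ENNReal.ofReal (∫ t, B t) := by
    rw [ofReal_integral_eq_lintegral_ofReal hB (Eventually.of_forall hB0),
      ← lintegral_const_mul' _ _ hVt]
    refine lintegral_mono fun t => ?_
    obtain ⟨A, hA1, hA2⟩ := h t
    calc ‖g (γ t) * deriv γ t‖ₑ * ∫⁻ w in Metric.ball z ρ, ‖γ t - w‖ₑ⁻¹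
        ≤ ‖g (γ t) * deriv γ t‖ₑ * (V * ENNReal.ofReal A) := by gcongr
      _ = V * ENNReal.ofReal (‖g (γ t) * deriv γ t‖ * A) := by
          rw [ENNReal.ofReal_mul (norm_nonneg _), ofReal_norm]
          ring
      _ ≤ V * ENNReal.ofReal (B t) := by gcongr
  have h3 : V * ‖f z‖ₑ ≤ V * ENNReal.ofReal ((2 * Real.pi)⁻¹ * (∫ t, B t) + G) := by
    calc V * ‖f z‖ₑ ≤ ∫⁻ w in Metric.ball z ρ, ‖f w‖ₑ := volume_ball_mul_enorm_le hf z ρ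
      _ ≤ ENNReal.ofReal (2 * Real.pi)⁻¹ * (V * ENNReal.ofReal (∫ t, B t)) +
          V * ENNReal.ofReal G := by
          refine h1.trans ?_
          gcongr
          refine (setLIntegral_cauchyTransform_le hγ hφ _).trans ?_
          gcongr
      _ = _ := by
          rw [ENNReal.ofReal_add (by positivity) hG, ENNReal.ofReal_mul (by positivity)]
          ring
  have h4 := (ENNReal.mul_le_mul_iff_right hV0 hVt).1 h3
  rw [← ofReal_norm] at h4
  exact (ENNReal.ofReal_le_ofReal_iff (by positivity)).1 h4

theorem norm_cauchyTransform_le {γ : ℝ → ℂ} {g f : ℂ → ℂ} {χ : ℂ → ℤ}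
    {C₁ C₂ C₃ C₄ C₅ δ₂ : ℝ} (hγ : Continuous γ)
    (hlim : Tendsto (fun τ => ‖γ τ‖) (atBot ⊔ atTop) atTop)
    (h0 : volume (range γ) = 0) (hφ : AEStronglyMeasurable (fun t => g (γ t) * deriv γ t))
    (h₁ : 1 ≤ C₁) (h₂ : 1 ≤ C₂) (h₃ : 1 ≤ C₃) (h₄ : 1 ≤ C₄) (h₅ : 1 ≤ C₅) (hδ₂ : 0 ≤ δ₂)
    (hC₁ : ∀ τ, ‖γ τ‖ ≤ C₁ * plusNorm τ)
    (hN : ∀ t, ‖g (γ t) * deriv γ t‖ ≤ C₂ * C₃ * plusNorm t ^ (-(2 + δ₂)))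
    (hC₅ : ∀ τ z, ‖z - γ τ‖ ≤ plusNorm τ ^ (-δ₂) / C₄ → ‖g z‖ ≤ C₅ * (plusNorm τ)⁻¹)
    (hf : Differentiable ℂ f) (hχ : ∀ w, χ w = 0 ∨ χ w = 1)
    (hfχ : ∀ w ∉ range γ, f w = cauchyTransform γ g w + χ w * g w) {z : ℂ} (hz : z ∉ range γ) :
    ‖cauchyTransform γ g z‖ ≤ 32 * (C₁ * C₂ * C₃ * C₄ * C₅) / plusNorm z := by
  have hZ := one_le_plusNorm z
  have hZ0 := plusNorm_pos z
  set r : ℝ → ℝ := fun t => plusNorm t ^ (-δ₂) / C₄ with hr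
  have hrpos : ∀ t, 0 < r t := fun t => by
    have := plusNorm_pos t
    simp only [hr]; positivity
  have hr1 : ∀ t, r t ≤ 1 := fun t => by
    have h5 : plusNorm t ^ (-δ₂) ≤ 1 :=
      Real.rpow_le_one_of_one_le_of_nonpos (one_le_plusNorm t) (by linarith)
    exact (div_le_one (by positivity)).2 (h5.trans h₄)
  have hrinv : ∀ t, (r t)⁻¹ = C₄ * plusNorm t ^ δ₂ := fun t => by
    simp only [hr]
    rw [inv_div, Real.rpow_neg (plusNorm_pos t).le, div_inv_eq_mul]
  have hranti : ∀ s t, plusNorm s ≤ plusNorm t → r t ≤ r s := fun s t hst => by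
    simp only [hr]
    exact div_le_div_of_nonneg_right
      (Real.rpow_le_rpow_of_nonpos (plusNorm_pos s) hst (by linarith)) (by positivity)
  have hB := integrable_cauchyMajorant (C₂ := C₂) (C₃ := C₃) (C₄ := C₄) h₁ hZ
  have hIB := integral_cauchyMajorant_le h₁ h₂ h₃ h₄ hZ
  have hprod : C₁ * C₂ * C₃ * C₄ ≤ C₁ * C₂ * C₃ * C₄ * C₅ :=
    le_mul_of_one_le_right (by positivity) h₅
  -- `r t` is the radius in the hypothesis on `g` near `γ t`. In the first case the kernel is at
  -- most `2 / r t`, so no averaging is needed.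
  by_cases hfar : ∀ t, r t / 2 < ‖z - γ t‖
  · have h6 := norm_cauchyTransform_le_of_kernel (γ := γ) (g := g) (z := z) hB (fun t => by
      have hpos : 0 < ‖γ t - z‖ := by
        rw [norm_sub_rev]
        linarith [hfar t, hrpos t]
      have hle : ‖cauchyIntegrand γ g z t‖ ≤ ‖g (γ t) * deriv γ t‖ * ‖γ t - z‖⁻¹ := by
        rw [mul_comm]
        exact norm_cauchyIntegrand_le hpos le_rfl
      refine hle.trans (mul_le_cauchyMajorant h₁ h₂ h₃ h₄ hZ hδ₂ (by positivity) (hN t)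
        (fun ht => ?_) fun _ => ?_)
      · obtain ⟨_, h7⟩ := half_le_of_plusNorm_le h₁ hC₁ ht
        rw [inv_le_comm₀ hpos (by positivity), inv_div]
        linarith
      · have h7 : ‖γ t - z‖⁻¹ ≤ (r t / 2)⁻¹ := by
          gcongr
          · have := hrpos t
            positivity
          · rw [norm_sub_rev]
            exact (hfar t).le
        have h8 : (0 : ℝ) ≤ C₄ * plusNorm t ^ δ₂ := by
          have := plusNorm_pos t
          positivity
        rw [inv_div, div_eq_mul_inv, hrinv] at h7
        linarith)
    refine h6.trans (hIB.trans ?_)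
    gcongr
    have : 0 ≤ C₁ * C₂ * C₃ * C₄ * C₅ := by positivity
    linarith
  · push Not at hfar
    set S : Set ℝ := {t | ‖z - γ t‖ ≤ r t / 2} with hS
    have hrc : Continuous r :=
      (continuous_plusNorm.rpow_const fun t => Or.inl (plusNorm_pos t).ne').div_const _
    have hScl : IsClosed S := isClosed_le (by fun_prop) (by fun_prop)
    have hScomp : IsCompact S := by
      refine ((isProperMap_of_tendsto hγ hlim).isCompact_preimage
        (isCompact_closedBall z 1)).of_isClosed_subset hScl fun t ht => ?_
      have ht' : ‖z - γ t‖ ≤ r t / 2 := ht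
      rw [mem_preimage, mem_closedBall_iff_norm, norm_sub_rev]
      linarith [hr1 t]
    -- Among the parameters whose curve points are close to `z`, the one of least `plusNorm` is
    -- chosen; its radius `r t₀` is the largest among them.
    obtain ⟨t₀, ht₀, hmin⟩ := hScomp.exists_isMinOn hfar continuous_plusNorm.continuousOn
    have ht₀' : ‖z - γ t₀‖ ≤ r t₀ / 2 := ht₀
    have hr0 := hrpos t₀
    set ρ := r t₀ / 4 with hρ
    have hρpos : 0 < ρ := by positivity
    have hwz : ∀ w ∈ Metric.ball z ρ, ∀ t, ‖γ t - z‖ - ρ ≤ ‖γ t - w‖ := fun w hw t => by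
      rw [mem_ball_iff_norm] at hw
      have : ‖γ t - z‖ ≤ ‖γ t - w‖ + ‖w - z‖ := by simpa using norm_add_le (γ t - w) (w - z)
      linarith
    set G := C₅ * (plusNorm t₀)⁻¹ with hG
    have hp0 := plusNorm_pos t₀
    have hG0 : 0 ≤ G := by positivity
    have hgG : ∀ w ∈ Metric.ball z ρ, ‖g w‖ ≤ G := fun w hw => hC₅ t₀ w (by
      rw [mem_ball_iff_norm] at hw
      have : ‖w - γ t₀‖ ≤ ‖w - z‖ + ‖z - γ t₀‖ := by
        simpa using norm_add_le (w - z) (z - γ t₀)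
      change ‖w - γ t₀‖ ≤ r t₀
      linarith)
    have hχg : ∀ w ∈ Metric.ball z ρ, ‖(χ w : ℂ) * g w‖ ≤ G := fun w hw => by
      rcases hχ w with h | h
      · simpa [h] using hG0
      · simpa [h] using hgG w hw
    have hfz := norm_le_of_average_kernel hγ hφ hf hρpos hG0 (by
      filter_upwards [compl_mem_ae_iff.2 h0] with w hw hwb
      rw [hfχ w hw]
      exact (norm_add_le _ _).trans (by linarith [hχg w hwb])) hB
      (cauchyMajorant_nonneg h₂ h₃ h₄ hZ) (fun t => by
      have hpt := plusNorm_pos t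
      by_cases ht : plusNorm t ≤ plusNorm z / (2 * C₁)
      · obtain ⟨h6, h7⟩ := half_le_of_plusNorm_le h₁ hC₁ ht
        refine ⟨(plusNorm z / 4)⁻¹, setLIntegral_ball_inv_enorm_le_of_dist measurableSet_ball
          subset_rfl (by positivity) fun w hw => ?_, ?_⟩
        · linarith [hwz w hw t, hr1 t₀]
        · refine mul_le_cauchyMajorant h₁ h₂ h₃ h₄ hZ hδ₂ (by positivity) (hN t) (fun _ => ?_)
            fun h => absurd ht (not_le.2 h)
          rw [inv_div]
      · by_cases htt : plusNorm t₀ ≤ plusNorm t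
        · refine ⟨3 / ρ, setLIntegral_ball_inv_enorm_le z (γ t) hρpos,
            mul_le_cauchyMajorant h₁ h₂ h₃ h₄ hZ hδ₂ (by positivity) (hN t)
            (fun h => absurd h ht) fun _ => ?_⟩
          have h6 : 3 / ρ = 12 * (r t₀)⁻¹ := by
            rw [hρ]
            field_simp
            norm_num
          have h7 : (r t₀)⁻¹ ≤ (r t)⁻¹ := inv_anti₀ (hrpos t) (hranti _ _ htt)
          rw [hrinv t] at h7
          rw [h6]
          linarith
        · have htS : r t / 2 < ‖z - γ t‖ := by
            by_contra! hcon
            exact htt (hmin (show t ∈ S from hcon))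
          have h6 := hranti t t₀ (not_le.1 htt).le
          have hrt := hrpos t
          refine ⟨(r t / 4)⁻¹, setLIntegral_ball_inv_enorm_le_of_dist measurableSet_ball
            subset_rfl (by positivity) fun w hw => ?_,
            mul_le_cauchyMajorant h₁ h₂ h₃ h₄ hZ hδ₂ (by positivity) (hN t)
            (fun h => absurd h ht) fun _ => ?_⟩
          · have := hwz w hw t
            rw [norm_sub_rev] at htS
            linarith
          · have h8 : (0 : ℝ) ≤ C₄ * plusNorm t ^ δ₂ := by positivity
            rw [inv_div, div_eq_mul_inv, hrinv]
            linarith)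
    have hhz : ‖cauchyTransform γ g z‖ ≤ ‖f z‖ + G := by
      have : cauchyTransform γ g z = f z - χ z * g z := by rw [hfχ z hz]; ring
      rw [this]
      exact (norm_sub_le _ _).trans (by linarith [hχg z (Metric.mem_ball_self hρpos)])
    -- `G` enters twice: in passing from `h` to `f` on the disc, and back from `f` to `h` at `z`.
    have hGle : 2 * G ≤ 4 * (C₁ * C₅) / plusNorm z := by
      have hzle : plusNorm z ≤ 2 * C₁ * plusNorm t₀ := by
        have h6 : 1 ≤ C₁ * plusNorm t₀ := one_le_mul_of_one_le_of_one_le h₁ (one_le_plusNorm t₀)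
        have h7 := hC₁ t₀
        have h8 : ‖z‖ ≤ ‖z - γ t₀‖ + ‖γ t₀‖ := by simpa using norm_add_le (z - γ t₀) (γ t₀)
        exact max_le (by linarith [hr1 t₀]) (by linarith)
      rw [hG, le_div_iff₀ hZ0, ← div_eq_mul_inv, mul_div_assoc', div_mul_eq_mul_div,
        div_le_iff₀ hp0]
      nlinarith
    have hC : C₁ * C₅ ≤ C₁ * C₂ * C₃ * C₄ * C₅ := by
      have h6 : 1 ≤ C₂ * C₃ * C₄ :=
        one_le_mul_of_one_le_of_one_le (one_le_mul_of_one_le_of_one_le h₂ h₃) h₄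
      calc C₁ * C₅ ≤ C₁ * C₅ * (C₂ * C₃ * C₄) := le_mul_of_one_le_right (by positivity) h6
        _ = _ := by ring
    calc ‖cauchyTransform γ g z‖
        ≤ 28 * (C₁ * C₂ * C₃ * C₄) / plusNorm z + 4 * (C₁ * C₅) / plusNorm z := by linarith
      _ = (28 * (C₁ * C₂ * C₃ * C₄) + 4 * (C₁ * C₅)) / plusNorm z := by ring
      _ ≤ _ := by
          gcongr
          linarith

/-! ### Assembly of the theorem -/

lemma intervalIntegrable_deriv {γ : ℝ → ℂ} {C₂ δ₁ : ℝ} (h₂ : 1 ≤ C₂)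
    (hγ' : ∀ τ, DifferentiableAt ℝ γ τ → ‖deriv γ τ‖ ≤ C₂ * plusNorm τ ^ δ₁) (a b : ℝ) :
    IntervalIntegrable (deriv γ) volume a b := by
  have hc : Continuous fun τ => C₂ * plusNorm τ ^ δ₁ := continuous_const.mul
    (continuous_plusNorm.rpow_const fun t => Or.inl (plusNorm_pos t).ne')
  refine (hc.intervalIntegrable a b).mono_fun' (measurable_deriv γ).aestronglyMeasurable
    (Eventually.of_forall fun τ => ?_)
  by_cases h : DifferentiableAt ℝ γ τ
  · exact hγ' τ h
  · simp only [deriv_zero_of_not_differentiableAt h, norm_zero]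
    have := plusNorm_pos τ
    positivity

end

theorem theorem2p1 :
    ∃ K : ℝ, 0 < K ∧
      ∀ (T T' : Set ℂ) (g : ℂ → ℂ) (γ : ℝ → ℂ) (C₁ C₂ C₃ C₄ C₅ δ₁ δ₂ : ℝ),
        IsOpen T → IsSimplyConnected T → DifferentiableOn ℂ g T →
        (∀ τ, γ τ ∈ T) → Function.Injective γ → IsPiecewiseSmooth γ →
        Tendsto (fun τ => ‖γ τ‖) (atBot ⊔ atTop) atTop →
        IsComponentOf T' (range γ)ᶜ → T' ⊆ T → RunsClockwiseAround γ T' →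
        1 ≤ C₁ → 1 ≤ C₂ → 1 ≤ C₃ → 1 ≤ C₄ → 1 ≤ C₅ → 0 ≤ δ₁ → 0 ≤ δ₂ →
        (∀ τ, ‖γ τ‖ ≤ C₁ * plusNorm τ) →
        (∀ τ, DifferentiableAt ℝ γ τ → ‖deriv γ τ‖ ≤ C₂ * plusNorm τ ^ δ₁) →
        (∀ τ, ‖g (γ τ)‖ ≤ C₃ * plusNorm τ ^ (-(2 + δ₁ + δ₂))) →
        (∀ τ z, ‖z - γ τ‖ ≤ plusNorm τ ^ (-δ₂) / C₄ →
          z ∈ T ∧ ‖g z‖ ≤ C₅ * (plusNorm τ)⁻¹) →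
        (∀ z ∉ range γ, Integrable (cauchyIntegrand γ g z)) ∧
        DifferentiableOn ℂ (cauchyTransform γ g) (range γ)ᶜ ∧
        (∃ f : ℂ → ℂ, Differentiable ℂ f ∧
          (∀ z ∈ T', f z = cauchyTransform γ g z + g z) ∧
          (∀ z, z ∉ T' → z ∉ range γ → f z = cauchyTransform γ g z)) ∧
        (∀ z ∉ range γ,
          ‖cauchyTransform γ g z‖ ≤ K * (C₁ * C₂ * C₃ * C₄ * C₅) / plusNorm z) := by
  classical
  -- `32 = 28 + 4`: the integral of the majorant, and the two occurrences of the bound for `g`.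
  refine ⟨32, by norm_num, ?_⟩
  intro T T' g γ C₁ C₂ C₃ C₄ C₅ δ₁ δ₂ hT _ hg hγT hinj hps hlim hT' hT'T hrun h₁ h₂ h₃ h₄ h₅ _ hδ₂
    hC₁ hC₂ hC₃ hC₅
  have hγ := hps.1
  have hm : AEStronglyMeasurable (fun t => g (γ t) * deriv γ t) :=
    (hg.continuousOn.comp_continuous hγ hγT).aestronglyMeasurable.mul
      (measurable_deriv γ).aestronglyMeasurable
  have hN := norm_density_le h₂ hC₂ hC₃
  have hφ := integrable_density h₂ h₃ hδ₂ hm hN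
  have hint := intervalIntegrable_deriv h₂ hC₂
  have hcl := isClosed_range_of_tendsto hγ hlim
  have hT'γ : T' ⊆ (range γ)ᶜ := by
    obtain ⟨z, _, rfl⟩ := hT'
    exact connectedComponentIn_subset _ _
  set χ : ℂ → ℤ := fun w => if w ∈ T' then 1 else 0 with hχdef
  have hχ : ∀ w w', w ∉ range γ → w' ∉ range γ →
      HasRelativeWindingNumber γ w w' (χ w' - χ w) := fun w w' hw hw' => by
    convert hrun.hasRelativeWindingNumber hps hinj hlim hT' hw hw' using 2
  have hdiff := differentiableOn_cauchyTransform hγ hlim hφ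
  have hglue : DifferentiableOn ℂ (fun w => cauchyTransform γ g w + χ w * g w) (range γ)ᶜ := by
    intro z hz
    have hU : connectedComponentIn (range γ)ᶜ z ∈ 𝓝 z :=
      hcl.isOpen_compl.connectedComponentIn.mem_nhds (mem_connectedComponentIn hz)
    -- Components of an open subset of the plane are open, so `χ` is locally constant off `γ`.
    have hχz : ∀ᶠ w in 𝓝 z, χ w = χ z := by
      filter_upwards [hU] with w hw
      obtain ⟨z₀, _, rfl⟩ := hT'
      have e1 := connectedComponentIn_eq hw
      have hiff : w ∈ connectedComponentIn (range γ)ᶜ z₀ ↔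
          z ∈ connectedComponentIn (range γ)ᶜ z₀ := by
        constructor <;> intro h
        · rw [connectedComponentIn_eq h, ← e1]
          exact mem_connectedComponentIn hz
        · rw [connectedComponentIn_eq h]
          exact hw
      simp only [hχdef, hiff]
    have hh := hdiff.differentiableAt (hcl.isOpen_compl.mem_nhds hz)
    have hd : DifferentiableAt ℂ (fun w => cauchyTransform γ g w + χ z * g w) z := by
      by_cases h : z ∈ T'
      · exact hh.add ((hg.differentiableAt (hT.mem_nhds (hT'T h))).const_mul _)
      · simpa [hχdef, h] using hh
    refine (hd.congr_of_eventuallyEq ?_).differentiableWithinAt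
    filter_upwards [hχz] with w hw
    rw [hw]
  obtain ⟨f, hf, hfeq⟩ := exists_entire_extension hcl hps.volume_range hglue (by
    rintro _ ⟨t₀, rfl⟩
    exact exists_local_extension hT hg hγT hps hinj hlim hint hφ hχ t₀)
  refine ⟨fun z hz => integrable_cauchyIntegrand hγ hlim hφ hz, hdiff,
    ⟨f, hf, fun z hz => ?_, fun z hz hzγ => ?_⟩, fun z hz => ?_⟩
  · rw [hfeq z (hT'γ hz)]
    simp [hχdef, hz]
  · rw [hfeq z hzγ]
    simp [hχdef, hz]
  · exact norm_cauchyTransform_le hγ hlim hps.volume_range hm h₁ h₂ h₃ h₄ h₅ hδ₂ hC₁ hN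
      (fun τ z h => (hC₅ τ z h).2) hf (fun w => by by_cases h : w ∈ T' <;> simp [hχdef, h])
      hfeq hz
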